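/- Work in the affine geometry $AG(4,3)=\mathbb{F}_3^4$, where a line is a set of three distinct points whose sum is $0$. A cap is a set of points containing no line; a maximal cap is a cap of largest possible size. For a point $a$, an $a$-line is a pair of points forming a line together with $a$. A point $a$ is an anchor point of a maximal cap $C$ if $C$ is the disjoint union of ten $a$-lines. A demicap is a cap which, for some point $a$, is the disjoint union of five $a$-lines such that no four of the corresponding lines through $a$ lie in a common hyperplane (three-dimensional affine subspace). A point $b$ completes a line with a pair $\{x,y\}$ of distinct points if $\{b,x,y\}$ is a line. Two disjoint maximal caps form a $1$-completable pair if they occur together in exactly one partition of $AG(4,3)$ whose blocks are four maximal caps and the singleton of an anchor point common to all four. For disjoint demicaps $E,F$ let $\kappa(E,F)$ be the set of points that complete exactly one line with a pair of points of $E$ and exactly one line with a pair of points of $F$; a decomposition of a maximal cap into disjoint demicaps $E,F$ is said to correspond to the set $\kappa(E,F)$. Let $C$ be a maximal cap and let $C=D\cup D'$ be a decomposition into two disjoint demicaps. Put $C'=\kappa(D,D')$. Then $C$ has a unique anchor point $a$, and the following hold. 1. Let $S_1$ be the set of points that complete a line with a pair of points of $D$ but with no pair of points of $D'$, and let $S_2$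 be the set of points that complete a line with a pair of points of $D'$ but with no pair of points of $D$. Then $|S_1|=|S_2|=20$, and each of $S_1$, $S_2$ is the union of an unordered pair of disjoint demicaps in exactly six ways. 2. Among all pairs $(E,F)$ of a demicap $E\subseteq S_1$ and a demicap $F\subseteq S_2$, there are exactly two, $(D_1,D_1')$ and $(D_2,D_2')$, for which $E\cup F$ is a maximal cap. Moreover $D_1,D_2$ are disjoint with union $S_1$, and $D_1',D_2'$ are disjoint with union $S_2$. Put $M_1=D_1\cup D_1'$ and $M_2=D_2\cup D_2'$. 3. $\{\{a\},C,C',M_1,M_2\}$ is a partition of $AG(4,3)$ into four maximal caps and their common anchor point $a$, and $\{C,C'\}$ and $\{M_1,M_2\}$ are $1$-completable pairs (so it is the unique such partition containing $C$ and $C'$, and also the unique one containing $M_1$ and $M_2$). 4. $M_1=D_1\cup D_1'$ and $M_2=D_2\cup D_2'$ are decompositions into disjoint demicaps, with $\kappa(D_1,D_1')=M_2$ and $\kappa(D_2,D_2')=M_1$. 5. Let $E$ be any of $D_1,D_1',D_2,D_2'$, let $D''$ be the set of points of $C'$ that complete exactly one line with a pair of points of $E$, and let $D'''=C'\setminus D''$.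 Then $D''$ and $D'''$ are demicaps, $\kappa(D'',D''')=C$, and $\{D'',D'''\}$ is the only unordered decomposition of $C'$ into two disjoint demicaps that corresponds to $C$. -/

import Mathlib

namespace AG43

/-- The points of the affine geometry `AG(4,3)`, coordinatized as `GF(3)⁴`. -/
abbrev Point : Type := Fin 4 → ZMod 3

/-- A line of `AG(4,3)`: three distinct points whose coordinate vectors sum to zero. -/
def IsLine (L : Finset Point) : Prop :=
  L.card = 3 ∧ ∑ x ∈ L, x = 0

/-- A cap: a set of points containing no line. -/
def IsCap (S : Finset Point) : Prop :=
  ∀ L ⊆ S, ¬ IsLine L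

/-- A maximal cap: a cap of largest possible size. -/
def IsMaximalCap (C : Finset Point) : Prop :=
  IsCap C ∧ ∀ S : Finset Point, IsCap S → S.card ≤ C.card

/-- An `a`-line: a pair of points which together with `a` forms a line. -/
def IsALine (a : Point) (p : Finset Point) : Prop :=
  p.card = 2 ∧ IsLine (insert a p)

/-- `S` is the disjoint union of exactly `k` many `a`-lines, the members of `ℓ`. -/
def IsALineDecomposition (a : Point) (k : ℕ) (ℓ : Finset (Finset Point)) (S : Finset Point) :
    Prop :=
  ℓ.card = k ∧ (∀ p ∈ ℓ, IsALine a p) ∧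
    (∀ p ∈ ℓ, ∀ q ∈ ℓ, p ≠ q → Disjoint p q) ∧ ℓ.biUnion id = S

/-- `a` is an anchor point of the cap `C`: the points of `C` are ten pairs, each of which makes
a line with `a`. -/
def IsAnchor (a : Point) (C : Finset Point) : Prop :=
  ∃ ℓ, IsALineDecomposition a 10 ℓ C

/-- A set of `a`-lines is co-hyperplanar if one affine hyperplane (a three-dimensional affine
subspace) contains all of the lines through `a` that they determine. -/
def CoHyperplanar (a : Point) (ℓ : Finset (Finset Point)) : Prop :=
  ∃ H : AffineSubspace (ZMod 3) Point, Module.finrank (ZMod 3) H.direction = 3 ∧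
    ∀ p ∈ ℓ, ∀ x ∈ insert a p, x ∈ H

/-- A demicap with anchor point `a`: a cap consisting of five `a`-lines, no four of which are
co-hyperplanar. -/
def IsDemicapAt (a : Point) (D : Finset Point) : Prop :=
  IsCap D ∧ ∃ ℓ, IsALineDecomposition a 5 ℓ D ∧
    ∀ m ⊆ ℓ, m.card = 4 → ¬ CoHyperplanar a m

/-- A demicap (with some anchor point). -/
def IsDemicap (D : Finset Point) : Prop :=
  ∃ a, IsDemicapAt a D

/-- `S` is the disjoint union of the demicaps `E` and `F`. -/
def IsDemicapDecomposition (S E F : Finset Point) : Prop :=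
  IsDemicap E ∧ IsDemicap F ∧ Disjoint E F ∧ E ∪ F = S

/-- The set of (unordered) ways of writing `S` as a union of two disjoint demicaps. -/
def demicapDecompositions (S : Finset Point) : Set (Finset (Finset Point)) :=
  {P | ∃ E F, IsDemicapDecomposition S E F ∧ P = {E, F}}

open Classical in
/-- The number of lines that the point `b` completes with pairs of points of `D`. -/
noncomputable def numLines (D : Finset Point) (b : Point) : ℕ :=
  ((D.powersetCard 2).filter (fun p => IsLine (insert b p))).card

/-- The set of points that complete exactly one line with a pair of points of `D` and exactly one
line with a pair of points of `D'`. -/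
noncomputable def correspondingCap (D D' : Finset Point) : Finset Point :=
  Finset.univ.filter (fun b => numLines D b = 1 ∧ numLines D' b = 1)

/-- The set of points that complete a line with a pair of points of `D` but complete no line with
a pair of points of `D'`. -/
noncomputable def completesOnly (D D' : Finset Point) : Finset Point :=
  Finset.univ.filter (fun b => 0 < numLines D b ∧ numLines D' b = 0)

/-- A partition of `AG(4,3)` whose blocks are four maximal caps together with the singleton of
their common anchor point `a`. -/
def IsCapPartition (a : Point) (P : Finpartition (Finset.univ : Finset Point)) : Prop :=
  P.parts.card = 5 ∧ {a} ∈ P.parts ∧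
    ∀ B ∈ P.parts, B ≠ {a} → IsMaximalCap B ∧ IsAnchor a B

/-- `{C, C'}` is a `k`-completable pair: `C` and `C'` are disjoint maximal caps that occur together
in exactly `k` partitions of `AG(4,3)` into four maximal caps and their common anchor point. -/
def IsCompletablePair (k : ℕ) (C C' : Finset Point) : Prop :=
  IsMaximalCap C ∧ IsMaximalCap C' ∧ Disjoint C C' ∧
    {P : Finpartition (Finset.univ : Finset Point) |
      (∃ a, IsCapPartition a P) ∧ C ∈ P.parts ∧ C' ∈ P.parts}.ncard = k

end AG43

open AG43

namespace AG43

/-! ### A binary model of the geometry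

A point is coded by a number with four base-four digits, each less than three, and a set of points by
a bit mask whose bits are indexed by the codes of its members. -/

/-! Up to bijections of the space that preserve lines, there is only one pair of disjoint demicaps
whose union is a cap. Once this is known, every claim is about one explicit configuration and is
settled by finite computation.

The first demicap is normalised by linear algebra (`IsDemicapAt.exists_coordinates`). Take its
centre as origin and choose one direction from each of its five lines. Any four directions are
independent, so they satisfy a linear relation with all coefficients nonzero, that is, `±1`. The set
is symmetric under negation, so the signs can be absorbed, and it becomes the four unit vectors, the
all-ones vector and their negatives. The second demicap avoids every point that completes a line
with the first. A search of the remaining points shows that each candidate is carried to a fixed one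
by permuting three coordinate axes (`exists_coordinates_of_isCap_union`).

The searches rest on two facts. A set is a demicap about `a` exactly when it is a cap, symmetric
about `a`, with five lines through `a`, and every other point completes at most one line with it
(`Coordinates.demicapB_iff_isDemicapAt`); this replaces hyperplanes by counting. Moreover, pruned
enumeration of unions of lines through a point misses no cap (`exists_mem_capExtensions`,
`exists_mem_capSplittings`). The second kind of search shows that a partition containing two given
caps has only one possibility for the other two blocks (`Coordinates.isCompletablePair_one`). -/

def codes : List ℕ := (List.range 256).filter fun n => (n &&& n >>> 1) &&& 85 == 0

/-- The code of the third point on the line through the points with codes `x` and `y`. -/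
def third (x y : ℕ) : ℕ :=
  -- Where two digits agree, the third digit is the same. Where they differ it is their exclusive or
  -- with 3. The factor `3 * (… &&& 85)` selects exactly the digits that differ.
  Nat.xor x (Nat.land (Nat.xor y 255)
    (Nat.mul 3 (Nat.land (Nat.lor (Nat.xor x y) (Nat.shiftRight (Nat.xor x y) 1)) 85)))

/-- `Nat.testBit`, in a form that the kernel evaluates quickly. -/
def hasBit (m i : ℕ) : Bool := Nat.beq (Nat.land (Nat.shiftRight m i) 1) 1

def elems (m : ℕ) : List ℕ := codes.filter (hasBit m)

def toMask (l : List ℕ) : ℕ := l.foldr (fun i m => m ||| 1 <<< i) 0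

def capB (m : ℕ) : Bool :=
  (elems m).all fun x => (elems m).all fun y => x.beq y || !hasBit m (third x y)

/-- The strict inequality counts each pair once, at its smaller member, and excludes `b` itself,
which is its own reflection. -/
def numB (m b : ℕ) : ℕ :=
  ((elems m).filter fun x => hasBit m (third b x) && x.blt (third b x)).length

def symB (a m : ℕ) : Bool :=
  (elems m).all fun x => !x.beq a && hasBit m (third a x)

/-- The hyperplane condition is replaced by a bound on completed lines: five at the centre and one
elsewhere. -/
def demicapB (a m : ℕ) : Bool :=
  symB a m && ((numB m a).beq 5 && (capB m && codes.all fun b => (numB m b).ble (bif b.beq a then 5 else 1)))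

/-- The pairs of codes of points of `m` that form a line with the point coded by `b`. -/
def pairs (b m : ℕ) : List (ℕ × ℕ) :=
  ((elems m).filter fun x => hasBit m (third b x) && x.blt (third b x)).map
    fun x => (x, third b x)

/-- A pruning test: it must never reject a point of a cap containing the current set, but survivors
need not be caps. -/
def extendsB (els : List ℕ) (m x : ℕ) : Bool :=
  els.all fun z => z.beq x || !hasBit m (third x z)

/-- The masks obtained by adding to the cap `m` with elements `els` exactly `k` of the given pairs,
discarding those for which a line appears. -/
def capExtensions : List (ℕ × ℕ) → ℕ → List ℕ → ℕ → List ℕ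
  | [], 0, _, m => [m]
  | [], _ + 1, _, _ => []
  | _ :: _, 0, _, m => [m]
  | (x, y) :: L, k + 1, els, m =>
    (bif extendsB els m x && extendsB els m y then
      capExtensions L k (x :: y :: els) (m ||| (1 <<< x ||| 1 <<< y)) else []) ++
    capExtensions L (k + 1) els m

/-- The first blocks of the ways of distributing the given pairs over the two caps `m` and `m'`,
discarding those for which a line appears. -/
def capSplittings : List (ℕ × ℕ) → List ℕ → ℕ → List ℕ → ℕ → List ℕ
  | [], _, m, _, _ => [m]
  | (x, y) :: L, els, m, els', m' =>
    (bif extendsB els m x && extendsB els m y then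
      capSplittings L (x :: y :: els) (m ||| (1 <<< x ||| 1 <<< y)) els' m' else []) ++
    (bif extendsB els' m' x && extendsB els' m' y then
      capSplittings L els m (x :: y :: els') (m' ||| (1 <<< x ||| 1 <<< y)) else [])

/-- The masks of the demicaps contained in `m`. -/
def demicaps (m : ℕ) : List ℕ :=
  codes.flatMap fun b => (capExtensions (pairs b m) 5 [] 0).filter (demicapB b)

/-- The masks of the demicaps contained in `r` whose union with the cap `c` is a cap. -/
def demicapComplements (c r : ℕ) : List ℕ :=
  codes.flatMap fun b =>
    ((capExtensions (pairs b r) 5 (elems c) c).map (· ^^^ c)).filter (demicapB b)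

def completesOnlyB (m n : ℕ) : ℕ :=
  toMask (codes.filter fun b => !(numB m b).beq 0 && (numB n b).beq 0)

def correspondsB (m n c : ℕ) : Bool :=
  codes.all fun b => hasBit c b == ((numB m b).beq 1 && (numB n b).beq 1)

def permCode (σ : Fin 4 → Fin 4) (n : ℕ) : ℕ :=
  n / 4 ^ (σ 0).val % 4 + 4 * (n / 4 ^ (σ 1).val % 4) + 16 * (n / 4 ^ (σ 2).val % 4) +
    64 * (n / 4 ^ (σ 3).val % 4)

def permMask (σ : Fin 4 → Fin 4) (m : ℕ) : ℕ := toMask ((elems m).map (permCode σ))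

/-- `maskD` is the normal form of a demicap and `maskD'` a chosen partner. `maskR` serves as the
region left for a partner of `maskD`. -/
def maskD : ℕ := 0x4000000000100000000002000010000000100010116
def maskD' : ℕ := 0x200014020000000102040000400000004002000000
def maskC : ℕ := 0x4200014020100000102042000410000004102010116
def maskC' : ℕ := 0x1050000050400000000001300320000050400320420
def maskS₁ : ℕ := 0x2400421001200000421024001040000001201040240
def maskS₂ : ℕ := 0x120342006000000254010406000000022004400000
def maskR : ℕ := 0x320356026000000356050406400000026006400000
def maskD₁ : ℕ := 0x2400001001000000001024001000000000200040000
def maskD₁' : ℕ := 0x120302000000000054010400000000000000000000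
def maskD₂ : ℕ := 0x420000200000420000000040000001001000240
def maskD₂' : ℕ := 0x40006000000200000006000000022004400000
def maskM₁ : ℕ := maskD₁ ||| maskD₁'
def maskM₂ : ℕ := maskD₂ ||| maskD₂'

/-! ### Lines, caps and decompositions into lines through a point -/

theorem add_self_eq_neg (x : Point) : x + x = -x := by
  funext i
  have : ∀ t : ZMod 3, t + t = -t := by decide
  exact this (x i)

theorem neg_add_eq_right_iff {a x : Point} : -(a + x) = x ↔ x = a := by
  rw [neg_eq_iff_add_eq_zero, add_assoc, add_self_eq_neg, ← sub_eq_add_neg, sub_eq_zero, eq_comm]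

theorem neg_add_eq_left_iff {a x : Point} : -(a + x) = a ↔ x = a := by
  rw [add_comm, neg_add_eq_right_iff, eq_comm]

theorem neg_add_neg_add (a x : Point) : -(a + -(a + x)) = x := by abel

theorem isLine_triple {x y : Point} (h : x ≠ y) : IsLine {x, y, -(x + y)} := by
  have h₁ : -(x + y) ≠ x := by rw [Ne, neg_add_eq_left_iff]; exact h.symm
  have h₂ : -(x + y) ≠ y := by rw [Ne, neg_add_eq_right_iff]; exact h.symm
  refine ⟨Finset.card_eq_three.2 ⟨_, _, _, h, h₁.symm, h₂.symm, rfl⟩, ?_⟩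
  rw [Finset.sum_insert (by simp [-neg_add_rev, h, h₁.symm]), Finset.sum_insert (by simp [-neg_add_rev, h₂.symm]),
    Finset.sum_singleton]
  abel

theorem isCap_iff {S : Finset Point} :
    IsCap S ↔ ∀ x ∈ S, ∀ y ∈ S, x ≠ y → -(x + y) ∉ S := by
  constructor
  · intro h x hx y hy hxy hz
    refine h _ ?_ (isLine_triple hxy)
    simp [-neg_add_rev, Finset.insert_subset_iff, hx, hy, hz]
  · rintro h L hL ⟨hc, hs⟩
    obtain ⟨x, y, z, hxy, hxz, hyz, rfl⟩ := Finset.card_eq_three.1 hc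
    rw [Finset.sum_insert (by simp [hxy, hxz]), Finset.sum_insert (by simp [hyz]),
      Finset.sum_singleton, ← add_assoc] at hs
    simp only [Finset.insert_subset_iff, Finset.singleton_subset_iff] at hL
    refine h x hL.1 y hL.2.1 hxy ?_
    rw [neg_eq_of_add_eq_zero_right hs]
    exact hL.2.2

theorem isALine_pair {a x : Point} (h : x ≠ a) : IsALine a {x, -(a + x)} := by
  refine ⟨Finset.card_pair fun h' => h (neg_add_eq_right_iff.1 h'.symm), isLine_triple h.symm⟩

theorem IsALine.exists_eq {a : Point} {p : Finset Point} (h : IsALine a p) :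
    ∃ x y, x ≠ y ∧ x ≠ a ∧ y ≠ a ∧ p = {x, y} ∧ a + x + y = 0 := by
  obtain ⟨hc, h3, hs⟩ := h
  obtain ⟨x, y, hxy, rfl⟩ := Finset.card_eq_two.1 hc
  have ha : a ∉ ({x, y} : Finset Point) := fun h' => by
    rw [Finset.insert_eq_of_mem h', hc] at h3
    omega
  rw [Finset.sum_insert ha, Finset.sum_pair hxy, ← add_assoc] at hs
  simp only [Finset.mem_insert, Finset.mem_singleton, not_or] at ha
  exact ⟨x, y, hxy, Ne.symm ha.1, Ne.symm ha.2, rfl, hs⟩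

theorem IsALine.eq_pair {a x : Point} {p : Finset Point} (h : IsALine a p) (hx : x ∈ p) :
    x ≠ a ∧ p = {x, -(a + x)} := by
  obtain ⟨y, z, hyz, hy, hz, rfl, hs⟩ := h.exists_eq
  rcases Finset.mem_insert.1 hx with rfl | hx
  · exact ⟨hy, by rw [neg_eq_of_add_eq_zero_right hs]⟩
  · rw [Finset.mem_singleton] at hx
    subst hx
    refine ⟨hz, ?_⟩
    rw [add_right_comm] at hs
    rw [neg_eq_of_add_eq_zero_right hs, Finset.pair_comm]

theorem IsALineDecomposition.card {a : Point} {k : ℕ} {ℓ : Finset (Finset Point)}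
    {S : Finset Point} (h : IsALineDecomposition a k ℓ S) : S.card = 2 * k := by
  obtain ⟨hk, hl, hd, rfl⟩ := h
  have h2 : ∀ p ∈ ℓ, (id p).card = 2 := fun p hp => (hl p hp).1
  rw [Finset.card_biUnion (t := id) hd, Finset.sum_congr rfl h2, Finset.sum_const, hk, smul_eq_mul,
    mul_comm]

/-- A set is the union of `k` disjoint `a`-lines if and only if it misses `a`, is invariant under the
reflection in `a`, and contains `k` pairs forming a line with `a`. -/
theorem exists_isALineDecomposition_iff {a : Point} {k : ℕ} {S : Finset Point} :
    (∃ ℓ, IsALineDecomposition a k ℓ S) ↔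
      (∀ x ∈ S, x ≠ a ∧ -(a + x) ∈ S) ∧ numLines S a = k := by
  classical
  constructor
  · rintro ⟨ℓ, hk, hl, hd, rfl⟩
    -- The pair containing `x` is forced, so `ℓ` consists of all pairs counted by `numLines`.
    have key : ∀ x ∈ ℓ.biUnion id, x ≠ a ∧ {x, -(a + x)} ∈ ℓ := by
      intro x hx
      obtain ⟨p, hp, hxp⟩ := Finset.mem_biUnion.1 hx
      obtain ⟨h₁, h₂⟩ := (hl p hp).eq_pair hxp
      exact ⟨h₁, h₂ ▸ hp⟩
    refine ⟨fun x hx => ⟨(key x hx).1, Finset.mem_biUnion.2 ⟨_, (key x hx).2, by simp⟩⟩, ?_⟩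
    rw [numLines, ← hk]
    congr 1
    ext p
    simp only [Finset.mem_filter, Finset.mem_powersetCard]
    constructor
    · rintro ⟨⟨hp, hc⟩, hL⟩
      obtain ⟨x, hx⟩ := Finset.card_pos.1 (hc ▸ Nat.zero_lt_two)
      rw [(IsALine.eq_pair ⟨hc, hL⟩ hx).2]
      exact (key x (hp hx)).2
    · exact fun hp => ⟨⟨Finset.subset_biUnion_of_mem id hp, (hl p hp).1⟩, (hl p hp).2⟩
  · rintro ⟨hS, hk⟩
    refine ⟨_, hk, ?_, ?_, ?_⟩
    · intro p hp
      simp only [Finset.mem_filter, Finset.mem_powersetCard] at hp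
      exact ⟨hp.1.2, hp.2⟩
    · intro p hp q hq hpq
      simp only [Finset.mem_filter, Finset.mem_powersetCard] at hp hq
      refine Finset.disjoint_left.2 fun x hxp hxq => hpq ?_
      rw [(IsALine.eq_pair ⟨hp.1.2, hp.2⟩ hxp).2, (IsALine.eq_pair ⟨hq.1.2, hq.2⟩ hxq).2]
    · ext x
      simp only [Finset.mem_biUnion, Finset.mem_filter, Finset.mem_powersetCard, id]
      constructor
      · rintro ⟨p, ⟨⟨hp, -⟩, -⟩, hx⟩
        exact hp hx
      · intro hx
        have := isALine_pair (hS x hx).1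
        exact ⟨_, ⟨⟨by simp [-neg_add_rev, Finset.insert_subset_iff, hx, (hS x hx).2], this.1⟩, this.2⟩, by simp⟩

theorem isLine_insert_of_sum_eq {b : Point} {p : Finset Point} (hp : p.card = 2) (hs : ∑ x ∈ p, x = -b)
    (hb : b ∉ p) : IsLine (insert b p) := by
  refine ⟨by rw [Finset.card_insert_of_notMem hb, hp], ?_⟩
  rw [Finset.sum_insert hb, hs, add_neg_cancel]

theorem card_filter_mem_of_finrank_eq_three (H : AffineSubspace (ZMod 3) Point)
    (h3 : Module.finrank (ZMod 3) H.direction = 3) {a : Point} (ha : a ∈ H)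
    [DecidablePred (· ∈ H)] : (Finset.univ.filter (· ∈ H)).card = 27 := by
  classical
  have h : Fintype.card H.direction = 27 := by
    rw [Module.card_eq_pow_finrank (K := ZMod 3), h3, ZMod.card]; rfl
  rw [← h, ← Finset.card_univ]
  symm
  refine Finset.card_bij (fun v _ => (v : Point) + a) ?_ ?_ ?_
  · intro v _
    simpa using AffineSubspace.vadd_mem_of_mem_direction v.2 ha
  · intro v _ w _ hvw
    exact Subtype.ext (add_right_cancel hvw)
  · intro p hp
    refine ⟨⟨p - a, AffineSubspace.vsub_mem_direction (by simpa using hp) ha⟩, Finset.mem_univ _, ?_⟩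
    simp

/-- A cap made of five `a`-lines is a demicap if no other point completes two lines with it. -/
theorem isDemicapAt_of_numLines_le {a : Point} {D : Finset Point} (hc : IsCap D)
    (hs : ∀ x ∈ D, x ≠ a ∧ -(a + x) ∈ D) (ha : numLines D a = 5)
    (hb : ∀ b ≠ a, numLines D b ≤ 1) : IsDemicapAt a D := by
  classical
  obtain ⟨ℓ, hl⟩ := exists_isALineDecomposition_iff.2 ⟨hs, ha⟩
  refine ⟨hc, ℓ, hl, ?_⟩
  rintro m hm hm4 ⟨H, h3, hH⟩
  have haH : a ∈ H := by
    obtain ⟨p, hp⟩ := Finset.card_pos.1 (by omega : 0 < m.card)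
    exact hH p hp a (Finset.mem_insert_self _ _)
  set Q := m.biUnion id with hQ
  have hQD : Q ⊆ D := by
    rw [← hl.2.2.2]
    exact Finset.biUnion_subset_biUnion_of_subset_left _ hm
  have hQH : ∀ x ∈ Q, x ∈ H := by
    intro x hx
    obtain ⟨p, hp, hxp⟩ := Finset.mem_biUnion.1 hx
    exact hH p hp x (Finset.mem_insert_of_mem hxp)
  have hQ8 : Q.card = 8 := IsALineDecomposition.card (a := a) (k := 4) (ℓ := m)
    ⟨hm4, fun p hp => hl.2.1 p (hm hp), fun p hp q hq => hl.2.2.1 p (hm hp) q (hm hq), rfl⟩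
  -- If four of the lines lay in `H`, their 8 points would leave 27 - 8 = 19 points of `H`. The
  -- third point on the line through any two of the 8 is one of these 19, since `H` is affine and
  -- `D` is a cap.
  set U := Finset.univ.filter (· ∈ H) \ Q with hU
  have hU19 : U.card = 19 := by
    rw [hU, Finset.card_sdiff_of_subset, card_filter_mem_of_finrank_eq_three H h3 haH, hQ8]
    intro x hx
    simpa using hQH x hx
  have haU : a ∈ U := by
    simp only [hU, Finset.mem_sdiff, Finset.mem_filter, Finset.mem_univ, true_and]
    exact ⟨haH, fun h => (hs a (hQD h)).1 rfl⟩
  have hmaps : ∀ p ∈ Q.powersetCard 2, -(∑ x ∈ p, x) ∈ U := by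
    intro p hp
    obtain ⟨hpQ, hp2⟩ := Finset.mem_powersetCard.1 hp
    obtain ⟨x, y, hxy, rfl⟩ := Finset.card_eq_two.1 hp2
    rw [Finset.sum_pair hxy]
    have hx : x ∈ Q := hpQ (by simp)
    have hy : y ∈ Q := hpQ (by simp)
    simp only [hU, Finset.mem_sdiff, Finset.mem_filter, Finset.mem_univ, true_and]
    refine ⟨?_, fun h => isCap_iff.1 hc x (hQD hx) y (hQD hy) hxy (hQD h)⟩
    have h₁ : (x - a) + (y - a) ∈ H.direction := Submodule.add_mem _
      (AffineSubspace.vsub_mem_direction (hQH x hx) haH)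
      (AffineSubspace.vsub_mem_direction (hQH y hy) haH)
    have h₂ := AffineSubspace.vadd_mem_of_mem_direction (Submodule.neg_mem _ h₁) haH
    have h₃ : -(x + y) = -((x - a) + (y - a)) + a := by
      have := add_self_eq_neg a
      calc -(x + y) = -((x - a) + (y - a)) + (-a + -a) := by abel
        _ = _ := by rw [← neg_add, this, neg_neg]
    rw [h₃]
    exact h₂
  have hfib : ∀ b ∈ U, ((Q.powersetCard 2).filter fun p => -(∑ x ∈ p, x) = b).card ≤
      if b = a then 5 else 1 := by
    intro b hbU
    have : ((Q.powersetCard 2).filter fun p => -(∑ x ∈ p, x) = b).card ≤ numLines D b := by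
      refine Finset.card_le_card fun p hp => ?_
      simp only [Finset.mem_filter, Finset.mem_powersetCard] at hp ⊢
      refine ⟨⟨hp.1.1.trans hQD, hp.1.2⟩, isLine_insert_of_sum_eq hp.1.2 (by rw [← hp.2, neg_neg]) ?_⟩
      exact fun h => (Finset.mem_sdiff.1 hbU).2 (hp.1.1 h)
    refine this.trans ?_
    split_ifs with h
    · rw [h, ha]
    · exact hb b h
  -- The 28 pairs from 8 points would have to fit into a capacity of 5 at `a` and 1 at each of 18
  -- other points, 23 in total.
  have h28 := Finset.card_eq_sum_card_fiberwise hmaps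
  rw [Finset.card_powersetCard, hQ8] at h28
  have h23 := Finset.sum_le_sum hfib
  have h5 : ∑ b ∈ U, (if b = a then 5 else 1) = 23 := by
    rw [← Finset.add_sum_erase _ _ haU, if_pos rfl, Finset.sum_congr rfl fun b hb' =>
      if_neg (Finset.ne_of_mem_erase hb'), Finset.sum_const, Finset.card_erase_of_mem haU, hU19]
    rfl
  rw [← h28, h5] at h23
  revert h23
  decide

/-! ### Coordinates -/

def pointCode (p : Point) : ℕ :=
  (p 0).val + 4 * (p 1).val + 16 * (p 2).val + 64 * (p 3).val

theorem pointCode_mem (p : Point) : pointCode p ∈ codes := by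
  have : ∀ a b c d : ZMod 3, a.val + 4 * b.val + 16 * c.val + 64 * d.val ∈ codes := by
    decide +kernel
  exact this _ _ _ _

theorem exists_pointCode_eq {n : ℕ} (hn : n ∈ codes) : ∃ p, pointCode p = n := by
  have : ∀ n ∈ codes, ∃ a b c d : ZMod 3, a.val + 4 * b.val + 16 * c.val + 64 * d.val = n := by
    decide +kernel
  obtain ⟨a, b, c, d, h⟩ := this n hn
  exact ⟨![a, b, c, d], h⟩

theorem pointCode_div_mod (p : Point) (i : Fin 4) : pointCode p / 4 ^ i.val % 4 = (p i).val := by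
  have h0 := ZMod.val_lt (p 0)
  have h1 := ZMod.val_lt (p 1)
  have h2 := ZMod.val_lt (p 2)
  have h3 := ZMod.val_lt (p 3)
  fin_cases i <;> simp [pointCode] <;> omega

theorem pointCode_injective : Function.Injective pointCode := fun p q h =>
  funext fun i => ZMod.val_injective 3 (by rw [← pointCode_div_mod, ← pointCode_div_mod, h])

theorem pointCode_third (p q : Point) :
    pointCode (-(p + q)) = third (pointCode p) (pointCode q) := by
  have : ∀ a b c d a' b' c' d' : ZMod 3, (-(a + a')).val + 4 * (-(b + b')).val +
      16 * (-(c + c')).val + 64 * (-(d + d')).val =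
      third (a.val + 4 * b.val + 16 * c.val + 64 * d.val)
        (a'.val + 4 * b'.val + 16 * c'.val + 64 * d'.val) := by
    decide +kernel
  exact this _ _ _ _ _ _ _ _

/-- A bijection of `AG(4,3)` onto itself that preserves lines. -/
structure Coordinates where
  toEquiv : Point ≃ Point
  map_third : ∀ x y, toEquiv (-(x + y)) = -(toEquiv x + toEquiv y)

namespace Coordinates

variable (e : Coordinates)

def code (p : Point) : ℕ := pointCode (e.toEquiv p)

theorem code_mem (p : Point) : e.code p ∈ codes := pointCode_mem _

theorem code_injective : Function.Injective e.code := pointCode_injective.comp e.toEquiv.injective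

theorem exists_code_eq {n : ℕ} (hn : n ∈ codes) : ∃ p, e.code p = n := by
  obtain ⟨q, hq⟩ := exists_pointCode_eq hn
  exact ⟨e.toEquiv.symm q, by rw [code, Equiv.apply_symm_apply, hq]⟩

theorem code_third (x y : Point) : e.code (-(x + y)) = third (e.code x) (e.code y) := by
  rw [code, e.map_third, pointCode_third]; rfl

/-- The set of points with a given bit mask. -/
def pts (m : ℕ) : Finset Point := Finset.univ.filter fun p => m.testBit (e.code p)

@[simp]
theorem mem_pts {m : ℕ} {p : Point} : p ∈ e.pts m ↔ m.testBit (e.code p) = true := by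
  simp [pts]

theorem forall_codes {P : ℕ → Prop} : (∀ n ∈ codes, P n) ↔ ∀ p, P (e.code p) := by
  refine ⟨fun h p => h _ (e.code_mem p), fun h n hn => ?_⟩
  obtain ⟨p, rfl⟩ := e.exists_code_eq hn
  exact h p

end Coordinates

/-- A number whose bits are indexed by codes of points. -/
def IsMask (m : ℕ) : Prop := ∀ i, m.testBit i = true → i ∈ codes

theorem hasBit_eq (m i : ℕ) : hasBit m i = m.testBit i := by
  rw [hasBit, Nat.testBit_eq_decide_div_mod_eq, ← Nat.shiftRight_eq_div_pow,
    ← Nat.and_one_is_mod, Bool.eq_iff_iff, Nat.beq_eq, decide_eq_true_iff]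
  rfl

theorem beq_eq_false_iff_ne {m n : ℕ} : m.beq n = false ↔ m ≠ n := by
  rw [← Bool.not_eq_true, Nat.beq_eq]

theorem mem_elems {m i : ℕ} : i ∈ elems m ↔ i ∈ codes ∧ m.testBit i = true := by
  simp [elems, hasBit_eq]

theorem testBit_one_shiftLeft {i j : ℕ} : (1 <<< i).testBit j = true ↔ j = i := by
  rw [Nat.one_shiftLeft, Nat.testBit_two_pow]
  simp [eq_comm]

theorem testBit_toMask {l : List ℕ} {i : ℕ} : (toMask l).testBit i = true ↔ i ∈ l := by
  induction l with
  | nil => simp [toMask]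
  | cons j l ih =>
    rw [toMask, List.foldr_cons, Nat.testBit_or, Bool.or_eq_true, testBit_one_shiftLeft, ← toMask,
      ih, List.mem_cons, or_comm]

theorem IsMask.ext {m n : ℕ} (hm : IsMask m) (hn : IsMask n)
    (h : ∀ i ∈ codes, m.testBit i = true ↔ n.testBit i = true) : m = n := by
  refine Nat.eq_of_testBit_eq fun i => ?_
  by_cases hi : i ∈ codes
  · exact Bool.eq_iff_iff.2 (h i hi)
  · rw [Bool.eq_false_iff.2 fun h' => hi (hm i h'), Bool.eq_false_iff.2 fun h' => hi (hn i h')]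

theorem isMask_toMask {l : List ℕ} (h : ∀ i ∈ l, i ∈ codes) : IsMask (toMask l) :=
  fun i hi => h i (testBit_toMask.1 hi)

theorem isMask_of_and_eq {m : ℕ} (h : m &&& toMask codes = m) : IsMask m := by
  intro i hi
  rw [← h, Nat.testBit_and, Bool.and_eq_true] at hi
  exact testBit_toMask.1 hi.2

theorem IsMask.or {m n : ℕ} (hm : IsMask m) (hn : IsMask n) : IsMask (m ||| n) := by
  intro i hi
  rw [Nat.testBit_or, Bool.or_eq_true] at hi
  exact hi.elim (hm i) (hn i)

theorem IsMask.xor {m n : ℕ} (hm : IsMask m) (hn : IsMask n) : IsMask (m ^^^ n) := by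
  intro i hi
  rw [Nat.testBit_xor] at hi
  by_cases h : m.testBit i = true
  · exact hm i h
  · exact hn i (by simpa [Bool.eq_false_iff.2 h] using hi)

theorem nodup_codes : codes.Nodup := List.nodup_range.filter _

theorem nodup_elems (m : ℕ) : (elems m).Nodup := nodup_codes.filter _

/-! ### Translation between masks and sets of points -/

namespace Coordinates

variable (e : Coordinates)

theorem exists_mask (S : Finset Point) : ∃ m, IsMask m ∧ e.pts m = S := by
  classical
  refine ⟨toMask (S.image e.code).toList, isMask_toMask ?_, ?_⟩
  · intro i hi
    obtain ⟨p, -, rfl⟩ := Finset.mem_image.1 (Finset.mem_toList.1 hi)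
    exact e.code_mem p
  · ext p
    rw [mem_pts, testBit_toMask, Finset.mem_toList, Finset.mem_image]
    exact ⟨fun ⟨q, hq, h⟩ => e.code_injective h ▸ hq, fun h => ⟨p, h, rfl⟩⟩

theorem pts_subset_pts {m n : ℕ} :
    e.pts m ⊆ e.pts n ↔ ∀ i ∈ codes, m.testBit i = true → n.testBit i = true := by
  rw [e.forall_codes]
  simp [Finset.subset_iff]

/-- Bits at positions that are not codes are invisible to `pts`, hence the restriction to masks. -/
theorem pts_injOn {m n : ℕ} (hm : IsMask m) (hn : IsMask n) (h : e.pts m = e.pts n) : m = n :=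
  hm.ext hn fun i hi => ⟨e.pts_subset_pts.1 h.le i hi, e.pts_subset_pts.1 h.ge i hi⟩

theorem pts_or (m n : ℕ) : e.pts (m ||| n) = e.pts m ∪ e.pts n := by
  ext p; simp

theorem pts_and (m n : ℕ) : e.pts (m &&& n) = e.pts m ∩ e.pts n := by
  ext p; simp

theorem disjoint_pts {m n : ℕ} (h : m &&& n = 0) : Disjoint (e.pts m) (e.pts n) := by
  rw [Finset.disjoint_iff_inter_eq_empty, ← pts_and, h]
  ext p; simp

theorem pts_xor_of_subset {m n : ℕ} (h : m &&& n = n) : e.pts (m ^^^ n) = e.pts m \ e.pts n := by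
  ext p
  have := congrArg (Nat.testBit · (e.code p)) h
  simp only [Nat.testBit_and] at this
  simp only [mem_pts, Nat.testBit_xor, Finset.mem_sdiff]
  revert this
  cases m.testBit (e.code p) <;> cases n.testBit (e.code p) <;> simp

theorem forall_elems {m : ℕ} {P : ℕ → Prop} :
    (∀ n ∈ elems m, P n) ↔ ∀ p ∈ e.pts m, P (e.code p) := by
  simp only [mem_elems, and_imp, mem_pts]
  exact e.forall_codes (P := fun n => m.testBit n = true → P n)

theorem image_code_pts (m : ℕ) : (e.pts m).image e.code = (elems m).toFinset := by
  ext i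
  rw [Finset.mem_image, List.mem_toFinset, mem_elems]
  constructor
  · rintro ⟨p, hp, rfl⟩
    exact ⟨e.code_mem p, e.mem_pts.1 hp⟩
  · rintro ⟨h, hm⟩
    obtain ⟨p, rfl⟩ := e.exists_code_eq h
    exact ⟨p, e.mem_pts.2 hm, rfl⟩

theorem card_pts (m : ℕ) : (e.pts m).card = (elems m).length := by
  rw [← Finset.card_image_of_injective _ e.code_injective, image_code_pts,
    List.toFinset_card_of_nodup (nodup_elems m)]

theorem capB_iff {m : ℕ} : capB m = true ↔ IsCap (e.pts m) := by
  simp only [capB, List.all_eq_true, e.forall_elems, isCap_iff, mem_pts, code_third]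
  refine forall₂_congr fun x _ => forall₂_congr fun y _ => ?_
  simp [hasBit_eq, e.code_injective.eq_iff, or_iff_not_imp_left]

theorem symB_iff {a : Point} {m : ℕ} :
    symB (e.code a) m = true ↔ ∀ x ∈ e.pts m, x ≠ a ∧ -(a + x) ∈ e.pts m := by
  simp only [symB, List.all_eq_true, e.forall_elems]
  refine forall₂_congr fun x _ => ?_
  rw [mem_pts, code_third]
  simp [hasBit_eq, beq_eq_false_iff_ne, e.code_injective.eq_iff]

/-- Each pair on a line with `b` corresponds to its member of smaller code; the two codes differ
because only `b` is fixed by the reflection in `b`. -/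
theorem numLines_pts (m : ℕ) (b : Point) : numLines (e.pts m) b = numB m (e.code b) := by
  classical
  have hnd := (nodup_elems m).filter fun x => hasBit m (third (e.code b) x) && x.blt (third (e.code b) x)
  rw [numB, ← List.toFinset_card_of_nodup hnd, numLines]
  symm
  have hb : ∀ x, third (e.code b) (e.code x) = e.code (-(b + x)) := fun x => (e.code_third b x).symm
  have hmem : ∀ x, e.code x ∈ ((elems m).filter fun x => hasBit m (third (e.code b) x) &&
      x.blt (third (e.code b) x)).toFinset ↔
      x ∈ e.pts m ∧ -(b + x) ∈ e.pts m ∧ e.code x < e.code (-(b + x)) := by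
    intro x
    rw [List.mem_toFinset, List.mem_filter, mem_elems, hb]
    simp [hasBit_eq, e.code_mem, -neg_add_rev]
  have hpt : ∀ i ∈ ((elems m).filter fun x => hasBit m (third (e.code b) x) &&
      x.blt (third (e.code b) x)).toFinset, ∃ x, e.code x = i := by
    intro i hi
    rw [List.mem_toFinset, List.mem_filter, mem_elems] at hi
    exact e.exists_code_eq hi.1.1
  choose! f hf using hpt
  refine Finset.card_bij (fun i _ => {f i, -(b + f i)}) ?_ ?_ ?_
  · intro i hi
    have h := hf i hi
    rw [← h, hmem] at hi
    have hne : f i ≠ b := by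
      intro h'
      rw [h', neg_add_eq_left_iff.2 rfl] at hi
      exact lt_irrefl _ hi.2.2
    have := isALine_pair hne
    rw [Finset.mem_filter, Finset.mem_powersetCard]
    exact ⟨⟨by simp only [Finset.insert_subset_iff, Finset.singleton_subset_iff]; exact ⟨hi.1, hi.2.1⟩,
      this.1⟩, this.2⟩
  · intro i hi j hj hij
    have h₁ := hf i hi
    have h₂ := hf j hj
    rw [← h₁, hmem] at hi
    rw [← h₂, hmem] at hj
    have h : f i ∈ ({f j, -(b + f j)} : Finset Point) := hij ▸ Finset.mem_insert_self _ _
    rcases Finset.mem_insert.1 h with h | h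
    · rw [← h₁, ← h₂, h]
    · rw [Finset.mem_singleton] at h
      rw [h, neg_add_neg_add] at hi
      exact absurd hi.2.2 hj.2.2.asymm
  · intro p hp
    rw [Finset.mem_filter, Finset.mem_powersetCard] at hp
    have hA : IsALine b p := ⟨hp.1.2, hp.2⟩
    have key : ∀ x ∈ p, e.code x < e.code (-(b + x)) → ∃ i, ∃ (_ : i ∈ ((elems m).filter fun x =>
        hasBit m (third (e.code b) x) && x.blt (third (e.code b) x)).toFinset),
        ({f i, -(b + f i)} : Finset Point) = p := by
      intro x hx hlt
      have hpx := (hA.eq_pair hx).2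
      have hmx := (hmem x).2 ⟨hp.1.1 hx, hp.1.1 (by rw [hpx]; simp), hlt⟩
      refine ⟨e.code x, hmx, ?_⟩
      rw [e.code_injective (hf _ hmx), ← hpx]
    obtain ⟨x, hx⟩ := Finset.card_pos.1 (by omega : 0 < p.card)
    obtain ⟨hxb, hpx⟩ := hA.eq_pair hx
    rcases lt_trichotomy (e.code x) (e.code (-(b + x))) with h | h | h
    · exact key x hx h
    · exact absurd (neg_add_eq_right_iff.1 (e.code_injective h).symm) hxb
    · refine key (-(b + x)) (by rw [hpx]; simp) ?_
      rwa [neg_add_neg_add]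

theorem demicapB_iff {a : Point} {m : ℕ} : demicapB (e.code a) m = true ↔
    (∀ x ∈ e.pts m, x ≠ a ∧ -(a + x) ∈ e.pts m) ∧ numLines (e.pts m) a = 5 ∧
      IsCap (e.pts m) ∧ ∀ b, b ≠ a → numLines (e.pts m) b ≤ 1 := by
  simp only [demicapB, Bool.and_eq_true, List.all_eq_true, e.forall_codes, e.symB_iff, e.capB_iff,
    ← e.numLines_pts, Nat.beq_eq]
  refine and_congr_right fun _ => and_congr_right fun ha => and_congr_right fun _ =>
    forall_congr' fun b => ?_
  by_cases hb : b = a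
  · subst hb
    simp [ha]
  · rw [beq_eq_false_iff_ne.2 fun h' => hb (e.code_injective h')]
    simp [hb]

end Coordinates

/-! ### The normal form of a demicap -/

/-- Translation commutes with taking the third point of a line because `3a = 0`. -/
noncomputable def Coordinates.ofBasis (a : Point) (b : Module.Basis (Fin 4) (ZMod 3) Point) : Coordinates where
  toEquiv := (Equiv.subRight a).trans b.equivFun.toEquiv
  map_third x y := by
    have h : -(x + y) - a = -((x - a) + (y - a)) := by
      calc -(x + y) - a = -(x + y) + -a := by abel
        _ = -(x + y) + (a + a) := by rw [add_self_eq_neg]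
        _ = _ := by abel
    simp only [Equiv.trans_apply, Equiv.subRight_apply, LinearEquiv.coe_toEquiv]
    rw [h, map_neg, map_add]

theorem Coordinates.ofBasis_apply (a : Point) (b : Module.Basis (Fin 4) (ZMod 3) Point) (p : Point) :
    (Coordinates.ofBasis a b).toEquiv p = b.equivFun (p - a) := rfl

theorem testBit_maskD (q : Point) : maskD.testBit (pointCode q) = true ↔
    (∃ i, q = Pi.single i 1 ∨ q = -Pi.single i 1) ∨ q = 1 ∨ q = -1 := by
  have : ∀ a b c d : ZMod 3,
      maskD.testBit (a.val + 4 * b.val + 16 * c.val + 64 * d.val) = true ↔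
      (∃ i, ![a, b, c, d] = Pi.single i 1 ∨ ![a, b, c, d] = -Pi.single i 1) ∨
        ![a, b, c, d] = 1 ∨ ![a, b, c, d] = -1 := by
    decide +kernel
  have h := this (q 0) (q 1) (q 2) (q 3)
  rwa [show ![q 0, q 1, q 2, q 3] = q by ext i; fin_cases i <;> rfl] at h

theorem smul_eq_self_or_neg {c : ZMod 3} (hc : c ≠ 0) (v : Point) : c • v = v ∨ c • v = -v := by
  have : ∀ c : ZMod 3, c ≠ 0 → c = 1 ∨ c = -1 := by decide
  rcases this c hc with rfl | rfl
  · exact Or.inl (one_smul _ _)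
  · exact Or.inr (by rw [neg_smul, one_smul])

/-- A proper subspace lies in the kernel of a nonzero functional, which has dimension 3. -/
theorem exists_hyperplane_of_span_ne_top {v : Fin 4 → Point}
    (h : Submodule.span (ZMod 3) (Set.range v) ≠ ⊤) :
    ∃ W : Submodule (ZMod 3) Point, Module.finrank (ZMod 3) W = 3 ∧ ∀ i, v i ∈ W := by
  obtain ⟨f, hf, hle⟩ := Submodule.exists_le_ker_of_lt_top _ (lt_top_iff_ne_top.2 h)
  refine ⟨LinearMap.ker f, ?_, fun i => hle (Submodule.subset_span ⟨i, rfl⟩)⟩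
  have := Module.Dual.finrank_ker_add_one_of_ne_zero hf
  rw [Module.finrank_fin_fun] at this
  omega

/-- The vectors are directions of the five lines. If four were dependent, their span would lie in a
three-dimensional `W`, and the hyperplane `a + W` would contain four of the lines. -/
theorem IsDemicapAt.exists_vectors {a : Point} {D : Finset Point} (h : IsDemicapAt a D) :
    ∃ u : Fin 5 → Point, (∀ p, p ∈ D ↔ ∃ i, p - a = u i ∨ p - a = -u i) ∧
      ∀ i : Fin 5, LinearIndependent (ZMod 3) fun j => u (i.succAbove j) := by
  classical
  obtain ⟨-, ℓ, ⟨hk, hl, -, rfl⟩, hco⟩ := h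
  let f := (ℓ.equivFinOfCardEq hk).symm
  have hx : ∀ i, ∃ x, (f i : Finset Point) = {x, -(a + x)} := by
    intro i
    obtain ⟨x, hx⟩ := Finset.card_pos.1 (by rw [(hl _ (f i).2).1]; omega : 0 < (f i : Finset Point).card)
    exact ⟨x, ((hl _ (f i).2).eq_pair hx).2⟩
  choose x hx using hx
  have hneg : ∀ i, -(a + x i) - a = -(x i - a) := by
    intro i
    have h3 := add_self_eq_neg a
    calc -(a + x i) - a = -(x i) + -(a + a) := by abel
      _ = -(x i) + a := by rw [h3, neg_neg]
      _ = _ := by abel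
  refine ⟨fun i => x i - a, ?_, ?_⟩
  · intro p
    rw [Finset.mem_biUnion]
    constructor
    · rintro ⟨q, hq, hp⟩
      obtain ⟨i, hi⟩ := f.surjective ⟨q, hq⟩
      have : q = {x i, -(a + x i)} := by rw [← hx, hi]
      rw [id, this, Finset.mem_insert, Finset.mem_singleton] at hp
      refine ⟨i, hp.imp ?_ ?_⟩
      · rintro rfl; rfl
      · rintro rfl; exact hneg i
    · rintro ⟨i, hi⟩
      refine ⟨f i, (f i).2, ?_⟩
      rw [id, hx, Finset.mem_insert, Finset.mem_singleton]
      rw [← hneg, sub_left_inj, sub_left_inj] at hi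
      exact hi
  · intro i
    by_contra hli
    have hspan : Submodule.span (ZMod 3) (Set.range fun j => x (i.succAbove j) - a) ≠ ⊤ := by
      intro htop
      refine hli (linearIndependent_of_top_le_span_of_card_eq_finrank htop.ge ?_)
      simp
    obtain ⟨W, hW, hxW⟩ := exists_hyperplane_of_span_ne_top hspan
    refine hco ((Finset.univ.erase i).image fun j => (f j : Finset Point)) ?_ ?_
      ⟨AffineSubspace.mk' a W, by rwa [AffineSubspace.direction_mk'], ?_⟩
    · intro q hq
      obtain ⟨j, -, rfl⟩ := Finset.mem_image.1 hq
      exact (f j).2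
    · rw [Finset.card_image_of_injective (f := fun j => (f j : Finset Point)) _
        (Subtype.val_injective.comp f.injective)]
      simp
    · intro q hq y hy
      obtain ⟨j, hj, rfl⟩ := Finset.mem_image.1 hq
      obtain ⟨k, rfl⟩ := Fin.exists_succAbove_eq (Finset.ne_of_mem_erase hj)
      rw [AffineSubspace.mem_mk']
      rw [hx, Finset.mem_insert, Finset.mem_insert, Finset.mem_singleton] at hy
      rcases hy with rfl | rfl | rfl
      · simp
      · exact hxW k
      · rw [vsub_eq_sub, hneg]
        exact W.neg_mem (hxW k)

theorem IsDemicapAt.exists_coordinates {a : Point} {D : Finset Point} (h : IsDemicapAt a D) :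
    ∃ e : Coordinates, e.code a = 0 ∧ e.pts maskD = D := by
  obtain ⟨u, hu, hli⟩ := h.exists_vectors
  -- Five vectors in dimension 4 are dependent. A vanishing coefficient would leave a relation among
  -- four of them, so none vanishes.
  obtain ⟨c, hc, k, hk⟩ : ∃ c : Fin 5 → ZMod 3, ∑ i, c i • u i = 0 ∧ ∃ i, c i ≠ 0 := by
    refine Fintype.not_linearIndependent_iff.1 fun hi => ?_
    have := hi.fintype_card_le_finrank
    simp at this
  have hc0 : ∀ i, c i ≠ 0 := by
    intro i hi
    rw [Fin.sum_univ_succAbove _ i, hi, zero_smul, zero_add] at hc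
    have hz := Fintype.linearIndependent_iff.1 (hli i) _ hc
    by_cases hik : k = i
    · exact hk (hik ▸ hi)
    · obtain ⟨j, rfl⟩ := Fin.exists_succAbove_eq hik
      exact hk (hz j)
  -- Rescaling by `c i = ±1` leaves the set `{u i, -u i}` unchanged and turns the relation into `∑ w
  -- i = 0`.
  set w : Fin 5 → Point := fun i => c i • u i with hw
  have hwli : LinearIndependent (ZMod 3) fun j : Fin 4 => w j.castSucc := by
    have := (hli (Fin.last 4)).units_smul fun j => Units.mk0 _ (hc0 j.castSucc)
    rw [Fin.succAbove_last] at this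
    exact this
  let b := basisOfLinearIndependentOfCardEqFinrank hwli (by simp)
  have hb : ∀ j, b j = w j.castSucc := fun j => by simp [b]
  have hlast : w (Fin.last 4) = -∑ j, b j := by
    rw [Fin.sum_univ_castSucc] at hc
    rw [eq_neg_iff_add_eq_zero, add_comm]
    simpa only [hb] using hc
  have hD : ∀ p, p ∈ D ↔ ∃ i, p - a = w i ∨ p - a = -w i := by
    intro p
    rw [hu]
    refine exists_congr fun i => ?_
    rcases smul_eq_self_or_neg (hc0 i) (u i) with h | h
    · simp only [hw, h]
    · simp only [hw, h, neg_neg, or_comm]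
  have h1 : b.equivFun (∑ j, b j) = 1 := by
    ext i
    simp [map_sum, Finset.sum_apply]
  have hs : ∀ j, b.equivFun (b j) = Pi.single j 1 := by
    intro j
    ext i
    rw [b.equivFun_self, Pi.single_apply]
    simp only [eq_comm]
  refine ⟨Coordinates.ofBasis a b, ?_, ?_⟩
  · rw [Coordinates.code, Coordinates.ofBasis_apply, sub_self, map_zero]
    rfl
  · ext p
    rw [Coordinates.mem_pts, Coordinates.code, Coordinates.ofBasis_apply, testBit_maskD, hD]
    rw [Fin.exists_fin_succ' (P := fun i => p - a = w i ∨ p - a = -w i), hlast, neg_neg, or_comm (a := p - a = -_)]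
    simp only [← hs, ← h1, ← map_neg, b.equivFun.injective.eq_iff, ← hb]

/-! ### Completeness of the searches -/

theorem extendsB_of_cap {M m x : ℕ} {els : List ℕ}
    (hM : ∀ x y, M.testBit x = true → M.testBit y = true → x ≠ y → ¬ M.testBit (third x y) = true)
    (hels : ∀ z ∈ els, M.testBit z = true) (hm : ∀ i, m.testBit i = true → M.testBit i = true)
    (hx : M.testBit x = true) : extendsB els m x = true := by
  simp only [extendsB, List.all_eq_true, Bool.or_eq_true, Nat.beq_eq, hasBit_eq]
  intro z hz
  rw [Bool.not_eq_true', ← Bool.not_eq_true, or_iff_not_imp_left]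
  exact fun hzx h => hM x z hx (hels z hz) (Ne.symm hzx) (hm _ h)

theorem testBit_or_pair {m x y i : ℕ} : (m ||| (1 <<< x ||| 1 <<< y)).testBit i = true ↔
    m.testBit i = true ∨ i = x ∨ i = y := by
  rw [Nat.testBit_or, Nat.testBit_or, Bool.or_eq_true, Bool.or_eq_true, testBit_one_shiftLeft,
    testBit_one_shiftLeft]

/-- `M` is the cap to be found. At each pair the search is followed along the branch that agrees
with `M`; the partial set stays inside `M`, so pruning never cuts this branch. -/
theorem exists_mem_capExtensions {M : ℕ}
    (hM : ∀ x y, M.testBit x = true → M.testBit y = true → x ≠ y → ¬ M.testBit (third x y) = true)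
    (L : List (ℕ × ℕ)) (hL : ∀ p ∈ L, M.testBit p.1 = true → M.testBit p.2 = true) (k : ℕ)
    (hk : (L.filter fun p => M.testBit p.1).length = k) (els : List ℕ) (m : ℕ)
    (hels : ∀ z ∈ els, M.testBit z = true) (hm : ∀ i, m.testBit i = true → M.testBit i = true) :
    ∃ r ∈ capExtensions L k els m, ∀ i, r.testBit i = true ↔ m.testBit i = true ∨
      ∃ p ∈ L, M.testBit p.1 = true ∧ (i = p.1 ∨ i = p.2) := by
  induction L generalizing k els m with
  | nil =>
    subst hk
    exact ⟨m, by simp [capExtensions], by simp⟩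
  | cons p L ih =>
    obtain ⟨x, y⟩ := p
    have hL' : ∀ p ∈ L, M.testBit p.1 = true → M.testBit p.2 = true :=
      fun p hp => hL p (List.mem_cons_of_mem _ hp)
    by_cases hx : M.testBit x = true
    · have hy : M.testBit y = true := hL _ List.mem_cons_self hx
      rw [List.filter_cons_of_pos (by exact hx), List.length_cons] at hk
      subst hk
      obtain ⟨r, hr, hri⟩ := ih hL' _ rfl (x :: y :: els) (m ||| (1 <<< x ||| 1 <<< y))
        (by
          intro z hz
          rcases List.mem_cons.1 hz with rfl | hz
          · exact hx
          rcases List.mem_cons.1 hz with rfl | hz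
          · exact hy
          · exact hels z hz)
        (by
          intro i hi
          rcases testBit_or_pair.1 hi with h | rfl | rfl
          exacts [hm i h, hx, hy])
      refine ⟨r, ?_, fun i => ?_⟩
      · rw [capExtensions, extendsB_of_cap hM hels hm hx, extendsB_of_cap hM hels hm hy]
        exact List.mem_append_left _ hr
      · rw [hri, testBit_or_pair]
        simp only [List.mem_cons, exists_eq_or_imp, hx, true_and, or_assoc]
    · rw [List.filter_cons_of_neg (by exact hx)] at hk
      obtain ⟨r, hr, hri⟩ := ih hL' k hk els m hels hm
      refine ⟨r, ?_, fun i => ?_⟩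
      -- When no pairs remain to be chosen, the search returns `m` whatever the tail of the list is.
      · cases k with
        | zero =>
          cases L with
          | nil => simpa [capExtensions] using hr
          | cons p L => simpa [capExtensions] using hr
        | succ k =>
          rw [capExtensions]
          exact List.mem_append_right _ hr
      · rw [hri]
        simp only [List.mem_cons, exists_eq_or_imp, hx, false_and, false_or, Bool.false_eq_true]

/-- Again the branch that agrees with the target survives; now every pair belongs wholly to `M` or
wholly to `N`. -/
theorem exists_mem_capSplittings {M N : ℕ}
    (hM : ∀ x y, M.testBit x = true → M.testBit y = true → x ≠ y → ¬ M.testBit (third x y) = true)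
    (hN : ∀ x y, N.testBit x = true → N.testBit y = true → x ≠ y → ¬ N.testBit (third x y) = true)
    (hMN : ∀ i, M.testBit i = true → ¬ N.testBit i = true)
    (L : List (ℕ × ℕ)) (hL : ∀ p ∈ L, (M.testBit p.1 = true ∧ M.testBit p.2 = true) ∨
      (N.testBit p.1 = true ∧ N.testBit p.2 = true))
    (els : List ℕ) (m : ℕ) (els' : List ℕ) (m' : ℕ)
    (hels : ∀ z ∈ els, M.testBit z = true) (hm : ∀ i, m.testBit i = true → M.testBit i = true)
    (hels' : ∀ z ∈ els', N.testBit z = true) (hm' : ∀ i, m'.testBit i = true → N.testBit i = true) :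
    ∃ r ∈ capSplittings L els m els' m', ∀ i, r.testBit i = true ↔ m.testBit i = true ∨
      ∃ p ∈ L, M.testBit p.1 = true ∧ (i = p.1 ∨ i = p.2) := by
  induction L generalizing els m els' m' with
  | nil => exact ⟨m, by simp [capSplittings], by simp⟩
  | cons p L ih =>
    obtain ⟨x, y⟩ := p
    have hL' : ∀ p ∈ L, (M.testBit p.1 = true ∧ M.testBit p.2 = true) ∨
      (N.testBit p.1 = true ∧ N.testBit p.2 = true) := fun p hp => hL p (List.mem_cons_of_mem _ hp)
    have grow : ∀ (A a : ℕ) (l : List ℕ), A.testBit x = true → A.testBit y = true →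
        (∀ z ∈ l, A.testBit z = true) → (∀ i, a.testBit i = true → A.testBit i = true) →
        (∀ z ∈ x :: y :: l, A.testBit z = true) ∧
        ∀ i, (a ||| (1 <<< x ||| 1 <<< y)).testBit i = true → A.testBit i = true := by
      intro A a l hx hy hl ha
      refine ⟨?_, fun i hi => ?_⟩
      · intro z hz
        rcases List.mem_cons.1 hz with rfl | hz
        · exact hx
        rcases List.mem_cons.1 hz with rfl | hz
        · exact hy
        · exact hl z hz
      · rcases testBit_or_pair.1 hi with h | rfl | rfl
        exacts [ha i h, hx, hy]
    rcases hL _ List.mem_cons_self with ⟨hx, hy⟩ | ⟨hx, hy⟩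
    · obtain ⟨h₁, h₂⟩ := grow M m els hx hy hels hm
      obtain ⟨r, hr, hri⟩ := ih hL' _ _ els' m' h₁ h₂ hels' hm'
      refine ⟨r, ?_, fun i => ?_⟩
      · rw [capSplittings, extendsB_of_cap hM hels hm hx, extendsB_of_cap hM hels hm hy]
        exact List.mem_append_left _ hr
      · rw [hri, testBit_or_pair]
        simp only [List.mem_cons, exists_eq_or_imp, hx, true_and, or_assoc]
    · obtain ⟨h₁, h₂⟩ := grow N m' els' hx hy hels' hm'
      obtain ⟨r, hr, hri⟩ := ih hL' els m _ _ hels hm h₁ h₂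
      have hx' : ¬ M.testBit x = true := fun h => hMN x h hx
      refine ⟨r, ?_, fun i => ?_⟩
      · rw [capSplittings, extendsB_of_cap hN hels' hm' hx, extendsB_of_cap hN hels' hm' hy]
        exact List.mem_append_right _ hr
      · rw [hri]
        simp only [List.mem_cons, exists_eq_or_imp, hx', false_and, false_or, Bool.false_eq_true]

/-! ### The searches applied to sets of points -/

namespace Coordinates

variable (e : Coordinates)

theorem not_testBit_third {M : ℕ} (hM : IsMask M) (hc : IsCap (e.pts M)) (x y : ℕ)
    (hx : M.testBit x = true) (hy : M.testBit y = true) (hxy : x ≠ y) :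
    ¬ M.testBit (third x y) = true := by
  obtain ⟨p, rfl⟩ := e.exists_code_eq (hM x hx)
  obtain ⟨q, rfl⟩ := e.exists_code_eq (hM y hy)
  rw [← e.code_third, ← e.mem_pts]
  exact isCap_iff.1 hc p (e.mem_pts.2 hx) q (e.mem_pts.2 hy) fun h => hxy (by rw [h])

theorem mem_pairs {b m : ℕ} {p : ℕ × ℕ} : p ∈ pairs b m ↔ p.1 ∈ elems m ∧
    m.testBit (third b p.1) = true ∧ p.1 < third b p.1 ∧ p.2 = third b p.1 := by
  obtain ⟨x, y⟩ := p
  simp only [pairs, List.mem_map, List.mem_filter, hasBit_eq, Bool.and_eq_true, Nat.blt_eq,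
    Prod.mk.injEq]
  constructor
  · rintro ⟨z, ⟨h₁, h₂, h₃⟩, rfl, rfl⟩
    exact ⟨h₁, h₂, h₃, rfl⟩
  · rintro ⟨h₁, h₂, h₃, rfl⟩
    exact ⟨x, ⟨h₁, h₂, h₃⟩, rfl, rfl⟩

/-- A set invariant under the reflection in `a` is covered by the pairs of a larger set. -/
theorem exists_mem_pairs_iff {a : Point} {E X : ℕ} (hE : IsMask E)
    (hs : ∀ x ∈ e.pts E, x ≠ a ∧ -(a + x) ∈ e.pts E) (hEX : e.pts E ⊆ e.pts X) (i : ℕ) :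
    (∃ p ∈ pairs (e.code a) X, E.testBit p.1 = true ∧ (i = p.1 ∨ i = p.2)) ↔
      E.testBit i = true := by
  constructor
  · rintro ⟨p, hp, hpE, h⟩
    obtain ⟨-, -, -, h4⟩ := mem_pairs.1 hp
    obtain ⟨x, hx⟩ := e.exists_code_eq (hE _ hpE)
    rw [← hx, ← e.mem_pts] at hpE
    rcases h with rfl | rfl
    · rw [← hx, ← e.mem_pts]; exact hpE
    · rw [h4, ← hx, ← e.code_third, ← e.mem_pts]; exact (hs x hpE).2
  · intro hi
    obtain ⟨x, rfl⟩ := e.exists_code_eq (hE _ hi)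
    have hx := e.mem_pts.2 hi
    obtain ⟨hxa, hx'⟩ := hs x hx
    have key : ∀ y ∈ e.pts E, -(a + y) ∈ e.pts E → e.code y < e.code (-(a + y)) →
        ∃ p ∈ pairs (e.code a) X, E.testBit p.1 = true ∧ p.1 = e.code y ∧ p.2 = e.code (-(a + y)) := by
      intro y hy hy' hlt
      refine ⟨(e.code y, e.code (-(a + y))), mem_pairs.2 ⟨mem_elems.2 ⟨e.code_mem y, ?_⟩, ?_⟩,
        e.mem_pts.1 hy, rfl, rfl⟩
      · exact e.mem_pts.1 (hEX hy)
      · rw [← e.code_third]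
        exact ⟨e.mem_pts.1 (hEX hy'), hlt, rfl⟩
    rcases lt_trichotomy (e.code x) (e.code (-(a + x))) with h | h | h
    · obtain ⟨p, hp, hpE, h₁, -⟩ := key x hx hx' h
      exact ⟨p, hp, hpE, Or.inl h₁.symm⟩
    · exact absurd (neg_add_eq_right_iff.1 (e.code_injective h).symm) hxa
    · obtain ⟨p, hp, hpE, -, h₂⟩ := key _ hx' (by rwa [neg_add_neg_add]) (by rwa [neg_add_neg_add])
      exact ⟨p, hp, hpE, Or.inr (by rw [h₂, neg_add_neg_add])⟩

theorem length_filter_pairs {a : Point} {E X : ℕ}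
    (hs : ∀ x ∈ e.pts E, x ≠ a ∧ -(a + x) ∈ e.pts E) (hEX : e.pts E ⊆ e.pts X) :
    ((pairs (e.code a) X).filter fun p => E.testBit p.1).length = numB E (e.code a) := by
  rw [pairs, List.filter_map, List.length_map, numB, List.filter_filter, elems, elems,
    List.filter_filter, List.filter_filter]
  congr 1
  refine List.filter_congr ?_
  rw [e.forall_codes]
  intro x
  rw [← e.code_third, Bool.eq_iff_iff]
  simp only [Function.comp, Bool.and_eq_true, hasBit_eq, ← e.mem_pts]
  constructor
  · rintro ⟨⟨h₁, h₂, h₃⟩, h₄⟩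
    exact ⟨⟨(hs x h₁).2, h₃⟩, h₁⟩
  · rintro ⟨⟨h₂, h₃⟩, h₁⟩
    exact ⟨⟨h₁, hEX h₂, h₃⟩, hEX h₁⟩

/-- The target of the search is the whole cap `E ||| c`. As `X` misses `c`, the pairs from `X` that
it selects are those of `E`. -/
theorem or_mem_capExtensions {a : Point} {E X c k : ℕ} (hE : IsMask E) (hc : IsMask c)
    (hs : ∀ x ∈ e.pts E, x ≠ a ∧ -(a + x) ∈ e.pts E) (hk : numLines (e.pts E) a = k)
    (hEX : e.pts E ⊆ e.pts X) (hX : X &&& c = 0) (hcap : IsCap (e.pts (E ||| c))) :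
    E ||| c ∈ capExtensions (pairs (e.code a) X) k (elems c) c := by
  have hXc : ∀ p ∈ pairs (e.code a) X, (E ||| c).testBit p.1 = true ↔ E.testBit p.1 = true := by
    intro p hp
    have h₁ := (mem_elems.1 (mem_pairs.1 hp).1).2
    have h₂ := congrArg (Nat.testBit · p.1) hX
    simp only [Nat.testBit_and, h₁, Bool.true_and, Nat.zero_testBit] at h₂
    rw [Nat.testBit_or, h₂, Bool.or_false]
  have hcover := e.exists_mem_pairs_iff hE hs hEX
  obtain ⟨r, hr, hri⟩ := exists_mem_capExtensions (e.not_testBit_third (hE.or hc) hcap)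
    (pairs (e.code a) X) (fun p hp h => by
      have := (hcover p.2).1 ⟨p, hp, (hXc p hp).1 h, Or.inr rfl⟩
      rw [Nat.testBit_or, this, Bool.true_or]) k
    (by
      rw [← hk, numLines_pts, ← e.length_filter_pairs hs hEX]
      congr 1
      exact List.filter_congr fun p hp => Bool.eq_iff_iff.2 (hXc p hp))
    (elems c) c
    (fun z hz => by rw [Nat.testBit_or, (mem_elems.1 hz).2, Bool.or_true])
    (fun i hi => by rw [Nat.testBit_or, hi, Bool.or_true])
  convert hr using 1
  refine Nat.eq_of_testBit_eq fun i => Bool.eq_iff_iff.2 ?_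
  rw [hri, Nat.testBit_or, Bool.or_eq_true, or_comm, ← hcover i]
  refine or_congr_right (exists_congr fun p => and_congr_right fun hp => ?_)
  rw [hXc p hp]

/-- One direction is the counting argument. For the other, the conditions do not depend on
coordinates, so it suffices to evaluate them on the normal form. -/
theorem demicapB_iff_isDemicapAt {a : Point} {m : ℕ} :
    demicapB (e.code a) m = true ↔ IsDemicapAt a (e.pts m) := by
  rw [demicapB_iff]
  constructor
  · rintro ⟨hs, ha, hc, hb⟩
    exact isDemicapAt_of_numLines_le hc hs ha hb
  · intro h
    obtain ⟨e', h0, hD⟩ := h.exists_coordinates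
    have : demicapB (e'.code a) maskD = true := by rw [h0]; decide +kernel
    rwa [demicapB_iff, hD] at this

theorem isDemicap_of_mem_demicaps {m X : ℕ} (h : m ∈ demicaps X) : IsDemicap (e.pts m) := by
  obtain ⟨b, hb, hm⟩ := List.mem_flatMap.1 h
  obtain ⟨a, rfl⟩ := e.exists_code_eq hb
  exact ⟨a, e.demicapB_iff_isDemicapAt.1 (List.mem_filter.1 hm).2⟩

theorem mem_demicaps {E X : ℕ} (hE : IsMask E) (h : IsDemicap (e.pts E))
    (hEX : e.pts E ⊆ e.pts X) : E ∈ demicaps X := by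
  obtain ⟨a, ha⟩ := h
  have hB := e.demicapB_iff_isDemicapAt.2 ha
  obtain ⟨hs, hk, hc, -⟩ := e.demicapB_iff.1 hB
  have h0 : E ||| 0 = E := Nat.or_zero E
  have := e.or_mem_capExtensions (c := 0) hE (fun i hi => by simp at hi) hs hk hEX (Nat.and_zero X)
    (by rwa [h0])
  rw [h0, show elems 0 = [] by decide +kernel] at this
  exact List.mem_flatMap.2 ⟨_, e.code_mem a, List.mem_filter.2 ⟨this, hB⟩⟩

theorem mem_demicapComplements {E c X : ℕ} (hE : IsMask E) (hc : IsMask c)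
    (h : IsDemicap (e.pts E)) (hEX : e.pts E ⊆ e.pts X) (hX : X &&& c = 0)
    (hcap : IsCap (e.pts E ∪ e.pts c)) : E ∈ demicapComplements c X := by
  obtain ⟨a, ha⟩ := h
  have hB := e.demicapB_iff_isDemicapAt.2 ha
  obtain ⟨hs, hk, -, -⟩ := e.demicapB_iff.1 hB
  have := e.or_mem_capExtensions hE hc hs hk hEX hX (by rwa [pts_or])
  refine List.mem_flatMap.2 ⟨_, e.code_mem a, List.mem_filter.2 ⟨List.mem_map.2 ⟨_, this, ?_⟩, hB⟩⟩
  refine Nat.eq_of_testBit_eq fun i => ?_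
  have h₁ : E.testBit i = true → c.testBit i = false := by
    intro hi
    have h₂ := congrArg (Nat.testBit · i) hX
    simp only [Nat.testBit_and, Nat.zero_testBit, e.pts_subset_pts.1 hEX i (hE i hi) hi,
      Bool.true_and] at h₂
    exact h₂
  rw [Nat.testBit_xor, Nat.testBit_or]
  revert h₁
  cases E.testBit i <;> cases c.testBit i <;> simp

/-- Coordinates with the axes permuted. -/
def perm (σ : Equiv.Perm (Fin 4)) : Coordinates where
  toEquiv := e.toEquiv.trans (σ.symm.arrowCongr (Equiv.refl _))
  map_third x y := by
    simp only [Equiv.trans_apply, e.map_third]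
    rfl

theorem code_perm (σ : Equiv.Perm (Fin 4)) (p : Point) :
    (e.perm σ).code p = permCode σ (e.code p) := by
  simp only [permCode, code, pointCode_div_mod]
  rfl

theorem pts_perm (σ : Equiv.Perm (Fin 4)) (m : ℕ) :
    (e.perm σ).pts (permMask σ m) = e.pts m := by
  ext p
  rw [mem_pts, permMask, testBit_toMask, List.mem_map]
  constructor
  · rintro ⟨n, hn, h⟩
    obtain ⟨q, rfl⟩ := e.exists_code_eq (mem_elems.1 hn).1
    rw [← code_perm] at h
    rw [← (e.perm σ).code_injective h, mem_pts]
    exact (mem_elems.1 hn).2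
  · intro hp
    exact ⟨_, mem_elems.2 ⟨e.code_mem p, e.mem_pts.1 hp⟩, (e.code_perm σ p).symm⟩

end Coordinates

/-! ### Standard form of a pair of demicaps -/

open Equiv in
-- The normal form is symmetric in the coordinates. The six permutations of the last three axes
-- already carry every possible partner to `maskD'`.
theorem exists_perm_of_mem_demicapComplements :
    ∀ m ∈ demicapComplements maskD maskR, ∃ σ ∈ [1, swap 1 2, swap 2 3, swap 1 3,
      swap (1 : Fin 4) 2 * swap 2 3, swap 2 3 * swap 1 2],
      permMask σ maskD = maskD ∧ permMask σ m = maskD' := by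
  decide +kernel

theorem mem_maskR : ∀ n ∈ codes,
    maskD.testBit n = true ∨ numB maskD n ≠ 0 ∨ maskR.testBit n = true := by
  decide +kernel

/-- Two disjoint demicaps whose union is a cap have a standard form. -/
theorem exists_coordinates_of_isCap_union {D D' : Finset Point} (hD : IsDemicap D)
    (hD' : IsDemicap D') (hdisj : Disjoint D D') (hcap : IsCap (D ∪ D')) :
    ∃ e : Coordinates, e.pts maskD = D ∧ e.pts maskD' = D' := by
  classical
  obtain ⟨a, ha⟩ := hD
  obtain ⟨e, -, rfl⟩ := ha.exists_coordinates
  obtain ⟨m, hm, rfl⟩ := e.exists_mask D'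
  -- A point of the second demicap on a line with two points of the first would violate the cap
  -- property of the union.
  have hsub : e.pts m ⊆ e.pts maskR := by
    intro p hp
    rw [Coordinates.mem_pts]
    rcases mem_maskR _ (e.code_mem p) with h | h | h
    · exact absurd hp (Finset.disjoint_left.1 hdisj (e.mem_pts.2 h))
    · rw [← e.numLines_pts] at h
      obtain ⟨q, hq⟩ := Finset.card_pos.1 (Nat.pos_of_ne_zero h)
      rw [Finset.mem_filter, Finset.mem_powersetCard] at hq
      refine absurd hq.2 (hcap _ (Finset.insert_subset (Finset.mem_union_right _ hp) ?_))
      exact hq.1.1.trans Finset.subset_union_left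
    · exact h
  have hmem := e.mem_demicapComplements (c := maskD) hm
    (isMask_of_and_eq (by decide +kernel)) hD' hsub (by decide +kernel)
    (by rwa [Finset.union_comm])
  obtain ⟨σ, -, h₁, h₂⟩ := exists_perm_of_mem_demicapComplements m hmem
  refine ⟨e.perm σ, ?_, ?_⟩
  · conv_lhs => rw [← h₁]
    exact e.pts_perm σ _
  · rw [← h₂]
    exact e.pts_perm σ _

/-! ### Evaluation of the model -/

/-- The smaller halves of the decompositions of `m` into two demicaps. -/
def decompositions (m : ℕ) : List ℕ :=
  (demicaps m).filter fun n => n.blt (m ^^^ n) && ((m &&& n).beq n && (demicaps m).contains (m ^^^ n))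

def maskG : ℕ := 0x1050000010000000000001300100000000400020000
def maskH : ℕ := 0x40400000000000000220000050000300420

/-- The mask is that of a cap consisting of ten lines through the point with code `0`. -/
def anchoredCapB (m : ℕ) : Bool :=
  ((m &&& toMask codes).beq m && (elems m).length.beq 20) &&
    -- The final test excludes other anchor points: an anchor point is a centre of symmetry.
    (capB m && (symB 0 m && ((numB m 0).beq 10 && codes.all fun b => !symB b m || b.beq 0)))

theorem anchoredCapB_all : [maskC, maskC', maskM₁, maskM₂].all anchoredCapB = true := by
  decide +kernel

theorem pairwise_masks : [1, maskC, maskC', maskM₁, maskM₂].Pairwise (· &&& · = 0) := by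
  decide +kernel

theorem or_masks : 1 ||| (maskC ||| (maskC' ||| (maskM₁ ||| maskM₂))) = toMask codes := by
  decide +kernel

theorem decompositions_maskS₁ :
    (decompositions maskS₁).Nodup ∧ (decompositions maskS₁).length = 6 := by
  decide +kernel

theorem decompositions_maskS₂ :
    (decompositions maskS₂).Nodup ∧ (decompositions maskS₂).length = 6 := by
  decide +kernel

theorem capSplittings_maskM : ∀ r ∈ capSplittings (pairs 0 (maskM₁ ||| maskM₂)) [] 0 [] 0,
    r = maskM₁ ∨ r = maskM₂ := by
  decide +kernel

theorem capSplittings_maskC : ∀ r ∈ capSplittings (pairs 0 (maskC ||| maskC')) [] 0 [] 0,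
    r = maskC ∨ r = maskC' := by
  decide +kernel

theorem eq_of_corresponds_maskC : ∀ m ∈ demicaps maskC',
    correspondsB m (maskC' ^^^ m) maskC = true → m = maskG ∨ m = maskH := by
  decide +kernel

/-- Requiring only a cap, not a maximal one, already leaves just two matchings. -/
theorem eq_of_capB_or : ∀ m ∈ demicaps maskS₁, ∀ n ∈ demicaps maskS₂, capB (m ||| n) = true →
    (m = maskD₁ ∧ n = maskD₁') ∨ (m = maskD₂ ∧ n = maskD₂') := by
  decide +kernel

theorem completesOnlyB_maskD :
    completesOnlyB maskD maskD' = maskS₁ ∧ completesOnlyB maskD' maskD = maskS₂ := by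
  decide +kernel

theorem correspondsB_all : correspondsB maskD maskD' maskC' = true ∧
    correspondsB maskD₁ maskD₁' maskM₂ = true ∧ correspondsB maskD₂ maskD₂' maskM₁ = true ∧
    correspondsB maskG maskH maskC = true ∧ correspondsB maskH maskG maskC = true := by
  decide +kernel

theorem demicapB_all :
    [maskD₁, maskD₁', maskD₂, maskD₂', maskG, maskH].all (demicapB 0) = true := by
  decide +kernel

/-- Which half of `maskC'` arises depends on the demicap chosen, but the unordered pair of halves
does not. -/
theorem completing_eq : ∀ m ∈ [maskD₁, maskD₁', maskD₂, maskD₂'],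
    (∀ b ∈ codes, maskG.testBit b = true ↔ maskC'.testBit b = true ∧ numB m b = 1) ∨
    ∀ b ∈ codes, maskH.testBit b = true ↔ maskC'.testBit b = true ∧ numB m b = 1 := by
  decide +kernel

/-! ### Transfer of the computed facts to sets of points -/

theorem IsDemicap.card {D : Finset Point} (h : IsDemicap D) : D.card = 10 := by
  obtain ⟨a, -, ℓ, hl, -⟩ := h
  exact hl.card

/-- Maximality is inherited from the given cap by comparing sizes, so the largest size of a cap
never has to be determined. -/
theorem IsMaximalCap.of_card_eq {C B : Finset Point} (hC : IsMaximalCap C) (hB : IsCap B)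
    (h : B.card = C.card) : IsMaximalCap B :=
  ⟨hB, fun S hS => (hC.2 S hS).trans h.ge⟩

theorem IsDemicapDecomposition.symm {S E F : Finset Point} (h : IsDemicapDecomposition S E F) :
    IsDemicapDecomposition S F E :=
  ⟨h.2.1, h.1, h.2.2.1.symm, by rw [Finset.union_comm]; exact h.2.2.2⟩

namespace Coordinates

variable (e : Coordinates)

theorem completesOnly_pts (m n : ℕ) :
    completesOnly (e.pts m) (e.pts n) = e.pts (completesOnlyB m n) := by
  ext p
  rw [completesOnly, mem_pts, completesOnlyB, testBit_toMask, List.mem_filter]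
  simp [numLines_pts, e.code_mem, beq_eq_false_iff_ne, Nat.pos_iff_ne_zero]

theorem correspondsB_iff {m n c : ℕ} :
    correspondsB m n c = true ↔ correspondingCap (e.pts m) (e.pts n) = e.pts c := by
  rw [correspondsB, List.all_eq_true, e.forall_codes, Finset.ext_iff]
  refine forall_congr' fun p => ?_
  rw [correspondingCap, mem_pts, Finset.mem_filter, beq_iff_eq, Bool.eq_iff_iff, hasBit_eq]
  rw [Bool.and_eq_true, Nat.beq_eq, Nat.beq_eq, ← numLines_pts, ← numLines_pts]
  simp only [Finset.mem_univ, true_and]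
  exact ⟨Iff.symm, Iff.symm⟩

/-- The properties of a cap with a unique anchor point, the one with code `0`. -/
theorem anchoredCapB_spec {m : ℕ} (h : anchoredCapB m = true) {a : Point} (ha : e.code a = 0) :
    IsMask m ∧ (e.pts m).card = 20 ∧ IsCap (e.pts m) ∧ ∀ b, IsAnchor b (e.pts m) ↔ b = a := by
  simp only [anchoredCapB, Bool.and_eq_true, Nat.beq_eq, List.all_eq_true, e.forall_codes,
    Bool.or_eq_true, ← ha, Bool.not_eq_true'] at h
  obtain ⟨⟨h₁, h₂⟩, h₃, h₄, h₅, h₆⟩ := h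
  refine ⟨isMask_of_and_eq h₁, by rw [card_pts, h₂], e.capB_iff.1 h₃, fun b => ?_⟩
  rw [IsAnchor, exists_isALineDecomposition_iff]
  constructor
  · rintro ⟨hb, -⟩
    rcases h₆ b with h | h
    · rw [e.symB_iff.2 hb] at h
      cases h
    · exact e.code_injective h
  · rintro rfl
    exact ⟨e.symB_iff.1 h₄, by rw [numLines_pts, h₅]⟩

theorem pts_xor_eq {m n x : ℕ} (hn : IsMask n) (hx : IsMask x) (hm : IsMask m)
    (hd : Disjoint (e.pts m) (e.pts n)) (hu : e.pts m ∪ e.pts n = e.pts x) :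
    n = x ^^^ m ∧ x &&& m = m := by
  have hxm : x &&& m = m := by
    refine IsMask.ext ?_ hm fun i hi => ?_
    · intro i hi
      rw [Nat.testBit_and, Bool.and_eq_true] at hi
      exact hm i hi.2
    · rw [Nat.testBit_and, Bool.and_eq_true, and_iff_right_iff_imp]
      exact e.pts_subset_pts.1 (hu ▸ Finset.subset_union_left) i hi
  refine ⟨e.pts_injOn hn (hx.xor hm) ?_, hxm⟩
  rw [e.pts_xor_of_subset hxm, ← hu, Finset.union_sdiff_cancel_left hd]

/-- The masks of the members of a decomposition into demicaps. -/
theorem exists_masks_of_decomposition {X : ℕ} (hX : IsMask X) {E F : Finset Point}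
    (h : IsDemicapDecomposition (e.pts X) E F) : ∃ m, IsMask m ∧ X &&& m = m ∧
      m ∈ demicaps X ∧ X ^^^ m ∈ demicaps X ∧ e.pts m = E ∧ e.pts (X ^^^ m) = F ∧ m ≠ X ^^^ m := by
  obtain ⟨m, hm, rfl⟩ := e.exists_mask E
  obtain ⟨n, hn, rfl⟩ := e.exists_mask F
  obtain ⟨hE, hF, hd, hu⟩ := h
  obtain ⟨rfl, hXm⟩ := e.pts_xor_eq hn hX hm hd hu
  refine ⟨m, hm, hXm, e.mem_demicaps hm hE (hu ▸ Finset.subset_union_left),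
    e.mem_demicaps hn hF (hu ▸ Finset.subset_union_right), rfl, rfl, fun h => ?_⟩
  rw [← h, disjoint_self, Finset.bot_eq_empty] at hd
  have := hE.card
  rw [hd] at this
  simp at this

/-- The second half is the complement of the first, so an unordered decomposition is recorded by the
smaller of its two masks. -/
theorem ncard_demicapDecompositions {X : ℕ} (hX : IsMask X) (hnd : (decompositions X).Nodup) :
    (demicapDecompositions (e.pts X)).ncard = (decompositions X).length := by
  classical
  have hmem : ∀ m, m ∈ decompositions X ↔
      m ∈ demicaps X ∧ m < X ^^^ m ∧ X &&& m = m ∧ X ^^^ m ∈ demicaps X := by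
    intro m
    simp [decompositions]
  have hmask : ∀ m, m ∈ decompositions X → IsMask m := by
    intro m hm i hi
    rw [← ((hmem m).1 hm).2.2.1, Nat.testBit_and, Bool.and_eq_true] at hi
    exact hX i hi.1
  have hset : demicapDecompositions (e.pts X) =
      ((decompositions X).toFinset.image fun m => ({e.pts m, e.pts (X ^^^ m)} : Finset _)) := by
    ext P
    rw [Finset.mem_coe, Finset.mem_image]
    constructor
    · rintro ⟨E, F, h, rfl⟩
      obtain ⟨m, hm, hXm, h₁, h₂, rfl, rfl, hne⟩ := e.exists_masks_of_decomposition hX h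
      rcases lt_or_gt_of_ne hne with hlt | hlt
      · exact ⟨m, List.mem_toFinset.2 ((hmem m).2 ⟨h₁, hlt, hXm, h₂⟩), rfl⟩
      · have hcancel : X ^^^ (X ^^^ m) = m := Nat.xor_xor_cancel_left X m
        refine ⟨X ^^^ m, List.mem_toFinset.2 ((hmem _).2 ⟨h₂, by rwa [hcancel], ?_, by rwa [hcancel]⟩), ?_⟩
        · rw [Nat.and_xor_distrib_left, Nat.and_self, hXm]
        · rw [hcancel, Finset.pair_comm]
    · rintro ⟨m, hm, rfl⟩
      obtain ⟨h₁, -, h₂, h₃⟩ := (hmem m).1 (List.mem_toFinset.1 hm)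
      refine ⟨_, _, ⟨e.isDemicap_of_mem_demicaps h₁, e.isDemicap_of_mem_demicaps h₃, ?_, ?_⟩, rfl⟩
      · rw [e.pts_xor_of_subset h₂]
        exact Finset.disjoint_sdiff
      · rw [e.pts_xor_of_subset h₂, Finset.union_sdiff_of_subset]
        rw [← h₂, pts_and]
        exact Finset.inter_subset_left
  rw [hset, Set.ncard_coe_finset, Finset.card_image_of_injOn, List.toFinset_card_of_nodup hnd]
  intro m hm n hn hmn
  rw [Finset.mem_coe, List.mem_toFinset] at hm hn
  have h : e.pts m ∈ ({e.pts n, e.pts (X ^^^ n)} : Finset _) := by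
    rw [← show _ = ({e.pts n, e.pts (X ^^^ n)} : Finset _) from hmn]
    exact Finset.mem_insert_self _ _
  rcases Finset.mem_insert.1 h with h | h
  · exact e.pts_injOn (hmask m hm) (hmask n hn) h
  · have h' := e.pts_injOn (hmask m hm) (hX.xor (hmask n hn)) (Finset.mem_singleton.1 h)
    have h₁ := ((hmem m).1 hm).2.1
    have h₂ := ((hmem n).1 hn).2.1
    rw [← h'] at h₂
    rw [h', Nat.xor_xor_cancel_left, ← h'] at h₁
    exact absurd h₁ h₂.asymm

theorem isDemicapDecomposition_pts {m n : ℕ} (hm : demicapB 0 m = true) (hn : demicapB 0 n = true)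
    (hd : m &&& n = 0) : IsDemicapDecomposition (e.pts (m ||| n)) (e.pts m) (e.pts n) := by
  obtain ⟨a, ha⟩ := e.exists_code_eq (n := 0) (by decide +kernel)
  rw [← ha] at hm hn
  exact ⟨⟨a, e.demicapB_iff_isDemicapAt.1 hm⟩, ⟨a, e.demicapB_iff_isDemicapAt.1 hn⟩,
    e.disjoint_pts hd, (e.pts_or m n).symm⟩

theorem pts_one {a : Point} (ha : e.code a = 0) : e.pts 1 = {a} := by
  ext p
  rw [mem_pts, Finset.mem_singleton, ← e.code_injective.eq_iff, ha]
  exact testBit_one_shiftLeft (i := 0)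

/-! ### Partitions and completable pairs -/

/-- Masks with disjoint bits that exhaust the codes define a partition of the geometry. -/
theorem exists_finpartition {l : List ℕ} (hd : l.Pairwise (· &&& · = 0))
    (hc : ∀ p, ∃ m ∈ l, p ∈ e.pts m) (hne : ∀ m ∈ l, (e.pts m).Nonempty) :
    ∃ P : Finpartition (Finset.univ : Finset Point), P.parts = l.toFinset.image e.pts := by
  have hd' : ∀ m ∈ l, ∀ n ∈ l, m ≠ n → Disjoint (e.pts m) (e.pts n) := by
    intro m hm n hn hmn
    have : Std.Symm fun x y : ℕ => x &&& y = 0 := ⟨fun x y h => by rwa [Nat.and_comm]⟩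
    exact e.disjoint_pts (hd.forall hm hn hmn)
  refine ⟨⟨l.toFinset.image e.pts, ?_, ?_, ?_⟩, rfl⟩
  · rw [Finset.supIndep_iff_pairwiseDisjoint]
    intro A hA B hB hAB
    simp only [Finset.coe_image, Set.mem_image, Finset.mem_coe, List.mem_toFinset] at hA hB
    obtain ⟨m, hm, rfl⟩ := hA
    obtain ⟨n, hn, rfl⟩ := hB
    exact hd' m hm n hn fun h => hAB (by rw [h])
  · refine Finset.eq_univ_of_forall fun p => ?_
    obtain ⟨m, hm, hp⟩ := hc p
    exact Finset.mem_sup.2 ⟨_, Finset.mem_image_of_mem _ (List.mem_toFinset.2 hm), hp⟩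
  · intro h
    obtain ⟨m, hm, h⟩ := Finset.mem_image.1 h
    exact (hne m (List.mem_toFinset.1 hm)).ne_empty h

/-- If the search finds only two ways to split a set into two caps, then there are no others with
anchor point `a`. -/
theorem eq_or_eq_of_capSplittings {a : Point} (ha : e.code a = 0) {m₁ m₂ : ℕ}
    (hsplit : ∀ r ∈ capSplittings (pairs 0 (m₁ ||| m₂)) [] 0 [] 0, r = m₁ ∨ r = m₂)
    {M N : Finset Point} (hM : IsCap M) (hN : IsCap N) (hMN : Disjoint M N)
    (hMa : IsAnchor a M) (hNa : IsAnchor a N) (hu : M ∪ N = e.pts m₁ ∪ e.pts m₂) :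
    M = e.pts m₁ ∨ M = e.pts m₂ := by
  obtain ⟨μ, hμ, rfl⟩ := e.exists_mask M
  obtain ⟨ν, hν, rfl⟩ := e.exists_mask N
  have hMs := (exists_isALineDecomposition_iff.1 hMa).1
  have hNs := (exists_isALineDecomposition_iff.1 hNa).1
  have hdisj : ∀ i, μ.testBit i = true → ¬ ν.testBit i = true := by
    intro i hi hi'
    obtain ⟨p, rfl⟩ := e.exists_code_eq (hμ i hi)
    exact Finset.disjoint_left.1 hMN (e.mem_pts.2 hi) (e.mem_pts.2 hi')
  -- Both caps are symmetric about `a`, so no pair through `a` is divided between them.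
  obtain ⟨r, hr, hri⟩ := exists_mem_capSplittings (e.not_testBit_third hμ hM)
    (e.not_testBit_third hν hN) hdisj (pairs (e.code a) (m₁ ||| m₂)) (fun p hp => by
      obtain ⟨h₁, -, -, h₄⟩ := mem_pairs.1 hp
      obtain ⟨h₁, h₂⟩ := mem_elems.1 h₁
      obtain ⟨x, hx⟩ := e.exists_code_eq h₁
      rw [h₄, ← hx, ← e.code_third]
      rw [← hx, ← e.mem_pts, e.pts_or, ← hu, Finset.mem_union] at h₂
      simp only [← e.mem_pts]
      exact h₂.imp (fun h => ⟨h, (hMs x h).2⟩) (fun h => ⟨h, (hNs x h).2⟩)) [] 0 [] 0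
    (by simp) (by simp) (by simp) (by simp)
  have hsub : e.pts μ ⊆ e.pts (m₁ ||| m₂) := by
    rw [pts_or, ← hu]
    exact Finset.subset_union_left
  have : r = μ := by
    refine Nat.eq_of_testBit_eq fun i => Bool.eq_iff_iff.2 ?_
    rw [hri, e.exists_mem_pairs_iff hμ hMs hsub]
    simp
  rw [ha] at hr
  rw [← this]
  exact (hsplit r hr).imp (fun h => by rw [h]) fun h => by rw [h]

/-- Two caps in a partition form a `1`-completable pair if the search for the remaining two has
only the expected results. -/
theorem isCompletablePair_one {a : Point} (ha : e.code a = 0) {c c' m₁ m₂ : ℕ}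
    (hA : ∀ m ∈ [c, c', m₁, m₂], IsMaximalCap (e.pts m) ∧ (e.pts m).card = 20 ∧
      ∀ b, IsAnchor b (e.pts m) ↔ b = a)
    (hd : [1, c, c', m₁, m₂].Pairwise (· &&& · = 0))
    (hu : 1 ||| (c ||| (c' ||| (m₁ ||| m₂))) = toMask codes)
    (hsplit : ∀ r ∈ capSplittings (pairs 0 (m₁ ||| m₂)) [] 0 [] 0, r = m₁ ∨ r = m₂) :
    (∃ P : Finpartition (Finset.univ : Finset Point),
      IsCapPartition a P ∧ P.parts = {{a}, e.pts c, e.pts c', e.pts m₁, e.pts m₂}) ∧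
    IsCompletablePair 1 (e.pts c) (e.pts c') := by
  classical
  have hcover : ∀ p, p ∈ e.pts 1 ∨ p ∈ e.pts c ∨ p ∈ e.pts c' ∨ p ∈ e.pts m₁ ∨ p ∈ e.pts m₂ := by
    intro p
    have : p ∈ e.pts (toMask codes) := e.mem_pts.2 (testBit_toMask.2 (e.code_mem p))
    simpa only [← hu, pts_or, Finset.mem_union] using this
  have hpos : ∀ m ∈ [1, c, c', m₁, m₂], (e.pts m).Nonempty := by
    intro m hm
    rcases List.mem_cons.1 hm with rfl | hm
    · exact ⟨a, by rw [e.pts_one ha]; simp⟩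
    · exact Finset.card_pos.1 (by rw [(hA m hm).2.1]; omega)
  have hdisj : Pairwise fun i j : Fin 5 =>
      Disjoint (e.pts ([1, c, c', m₁, m₂].get i)) (e.pts ([1, c, c', m₁, m₂].get j)) := by
    intro i j hij
    rw [List.pairwise_iff_get] at hd
    rcases lt_or_gt_of_ne hij with h | h
    · exact e.disjoint_pts (hd i j h)
    · exact (e.disjoint_pts (hd j i h)).symm
  have hne : Function.Injective fun i : Fin 5 => e.pts ([1, c, c', m₁, m₂].get i) := by
    intro i j hij
    by_contra h
    have : Disjoint (e.pts _) (e.pts _) := hdisj h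
    rw [show e.pts ([1, c, c', m₁, m₂].get i) = _ from hij, disjoint_self] at this
    exact (hpos _ (List.get_mem _ _)).ne_empty this
  obtain ⟨P, hP⟩ := e.exists_finpartition hd (fun p => by simpa using hcover p) hpos
  have hparts : P.parts = {{a}, e.pts c, e.pts c', e.pts m₁, e.pts m₂} := by
    rw [hP, ← e.pts_one ha]
    simp [Finset.image_insert]
  have hcard : P.parts.card = 5 := by
    have : P.parts = Finset.univ.image fun i : Fin 5 => e.pts ([1, c, c', m₁, m₂].get i) := by
      rw [hparts, ← e.pts_one ha]
      ext B
      simp [Fin.exists_fin_succ, eq_comm]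
    rw [this, Finset.card_image_of_injective _ hne]
    rfl
  have hPa : IsCapPartition a P := by
    refine ⟨hcard, by simp [hparts], fun B hB hBa => ?_⟩
    have : ∃ m ∈ [c, c', m₁, m₂], B = e.pts m := by
      rw [hparts, Finset.mem_insert] at hB
      simpa using hB.resolve_left hBa
    obtain ⟨m, hm, rfl⟩ := this
    exact ⟨(hA m hm).1, ((hA m hm).2.2 a).2 rfl⟩
  have hsingle : ∀ b, ∀ m ∈ [c, c', m₁, m₂], e.pts m ≠ {b} := by
    intro b m hm h
    have := (hA m hm).2.1
    rw [h] at this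
    simp at this
  have hcc' : Disjoint (e.pts c) (e.pts c') := hdisj (i := 1) (j := 2) (by decide)
  refine ⟨⟨P, hPa, hparts⟩, (hA c (by simp)).1, (hA c' (by simp)).1, hcc', ?_⟩
  rw [Set.ncard_eq_one]
  refine ⟨P, Set.eq_singleton_iff_unique_mem.2 ⟨⟨⟨a, hPa⟩, by simp [hparts], by simp [hparts]⟩, ?_⟩⟩
  rintro Q ⟨⟨b, hQ5, hQb, hQ⟩, hc, hc'⟩
  -- A competing partition has the same centre, since one of its blocks is a cap whose only anchor
  -- point is `a`.
  have hb : b = a :=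
    ((hA c (by simp)).2.2 b).1 (hQ _ hc (hsingle b c (by simp))).2
  subst hb
  have h3 : ({{b}, e.pts c, e.pts c'} : Finset (Finset Point)) ⊆ Q.parts := by
    simp [Finset.insert_subset_iff, hQb, hc, hc']
  have h3c : ({{b}, e.pts c, e.pts c'} : Finset (Finset Point)).card = 3 := by
    refine Finset.card_eq_three.2 ⟨_, _, _, (hsingle b c (by simp)).symm,
      (hsingle b c' (by simp)).symm, ?_, rfl⟩
    exact fun h => absurd (hne (a₁ := 1) (a₂ := 2) h) (by decide)
  obtain ⟨M, N, hMN, hT⟩ := Finset.card_eq_two.1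
    (show (Q.parts \ {{b}, e.pts c, e.pts c'}).card = 2 by
      rw [Finset.card_sdiff_of_subset h3, hQ5, h3c])
  have hTmem : ∀ A, (A = M ∨ A = N) ↔ A ∈ Q.parts ∧ A ≠ {b} ∧ A ≠ e.pts c ∧ A ≠ e.pts c' := by
    intro A
    have := congrArg (A ∈ ·) hT
    simpa [eq_comm, iff_comm] using this
  obtain ⟨hMQ, hM₁, hM₂, hM₃⟩ := (hTmem M).1 (Or.inl rfl)
  obtain ⟨hNQ, hN₁, hN₂, hN₃⟩ := (hTmem N).1 (Or.inr rfl)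
  have hsub : ∀ A ∈ Q.parts, A ≠ {b} → A ≠ e.pts c → A ≠ e.pts c' →
      A ⊆ e.pts m₁ ∪ e.pts m₂ := by
    intro A hAQ h₁ h₂ h₃ p hp
    rcases hcover p with h | h | h | h | h
    · rw [e.pts_one ha] at h
      exact absurd h (Finset.disjoint_left.1 (Q.disjoint hAQ hQb h₁) hp)
    · exact absurd h (Finset.disjoint_left.1 (Q.disjoint hAQ hc h₂) hp)
    · exact absurd h (Finset.disjoint_left.1 (Q.disjoint hAQ hc' h₃) hp)
    · exact Finset.mem_union_left _ h
    · exact Finset.mem_union_right _ h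
  -- The two unknown blocks fill exactly what the three known blocks leave, which reduces uniqueness
  -- to the splitting search.
  have hMNu : M ∪ N = e.pts m₁ ∪ e.pts m₂ := by
    refine (Finset.union_subset (hsub M hMQ hM₁ hM₂ hM₃) (hsub N hNQ hN₁ hN₂ hN₃)).antisymm ?_
    intro p hp
    obtain ⟨A, hAQ, hpA⟩ := Q.exists_mem (Finset.mem_univ p)
    have hnot : ∀ i : Fin 5, i < 3 → p ∉ e.pts ([1, c, c', m₁, m₂].get i) := by
      intro i hi
      rcases Finset.mem_union.1 hp with h | h
      · exact Finset.disjoint_left.1 (hdisj (i := 3) (j := i) (by omega)) h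
      · exact Finset.disjoint_left.1 (hdisj (i := 4) (j := i) (by omega)) h
    have := (hTmem A).2 ⟨hAQ, ?_, ?_, ?_⟩
    · rcases this with rfl | rfl
      · exact Finset.mem_union_left _ hpA
      · exact Finset.mem_union_right _ hpA
    · rintro rfl
      exact hnot 0 (by decide) (by rw [← e.pts_one ha] at hpA; exact hpA)
    · rintro rfl
      exact hnot 1 (by decide) hpA
    · rintro rfl
      exact hnot 2 (by decide) hpA
  have hdMN : Disjoint M N := Q.disjoint hMQ hNQ hMN
  have hMc := hQ M hMQ hM₁
  have hNc := hQ N hNQ hN₁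
  have hM := e.eq_or_eq_of_capSplittings ha hsplit hMc.1.1 hNc.1.1 hdMN hMc.2 hNc.2 hMNu
  have hN := e.eq_or_eq_of_capSplittings ha hsplit hNc.1.1 hMc.1.1 hdMN.symm hNc.2 hMc.2
    (by rw [Finset.union_comm, hMNu])
  -- Both partitions have five parts, so one inclusion suffices.
  refine Finpartition.ext (Finset.eq_of_subset_of_card_le ?_ (by rw [hcard, hQ5]))
  intro A hAQ
  rw [hparts]
  by_cases h : A ≠ {b} ∧ A ≠ e.pts c ∧ A ≠ e.pts c'
  · rcases (hTmem A).2 ⟨hAQ, h⟩ with rfl | rfl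
    · rcases hM with h | h <;> simp [h]
    · rcases hN with h | h <;> simp [h]
  · rw [← not_or, ← not_or, not_not] at h
    rcases h with h | h | h <;> simp [h]

end Coordinates

end AG43

/-! ### The main theorem -/

open AG43
theorem mainTheorem3
    (C D D' C' S₁ S₂ : Finset Point)
    (hC : IsMaximalCap C)
    (hD : IsDemicapDecomposition C D D')
    (hC' : C' = correspondingCap D D')
    (hS₁ : S₁ = completesOnly D D')
    (hS₂ : S₂ = completesOnly D' D) :
    -- `a` is the anchor point of `C`
    ∃ a : Point, (∀ b, IsAnchor b C ↔ b = a) ∧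
    -- the sets `S₁` and `S₂` and their demicap decompositions
    S₁.card = 20 ∧ S₂.card = 20 ∧
    (demicapDecompositions S₁).ncard = 6 ∧ (demicapDecompositions S₂).ncard = 6 ∧
    -- exactly two matchings of demicaps in `S₁` with demicaps in `S₂` give maximal caps
    ∃ D₁ D₁' D₂ D₂' M₁ M₂ : Finset Point,
      IsDemicapDecomposition S₁ D₁ D₂ ∧ IsDemicapDecomposition S₂ D₁' D₂' ∧
      M₁ = D₁ ∪ D₁' ∧ M₂ = D₂ ∪ D₂' ∧ IsMaximalCap M₁ ∧ IsMaximalCap M₂ ∧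
      (∀ E F : Finset Point, IsDemicap E → E ⊆ S₁ → IsDemicap F → F ⊆ S₂ →
        (IsMaximalCap (E ∪ F) ↔ (E = D₁ ∧ F = D₁') ∨ (E = D₂ ∧ F = D₂'))) ∧
      -- the partition into two 1-completable pairs
      (∃ P : Finpartition (Finset.univ : Finset Point),
        IsCapPartition a P ∧ P.parts = {{a}, C, C', M₁, M₂}) ∧
      IsCompletablePair 1 C C' ∧ IsCompletablePair 1 M₁ M₂ ∧
      -- the decompositions of `M₁` and `M₂` correspond to the other cap
      IsDemicapDecomposition M₁ D₁ D₁' ∧ correspondingCap D₁ D₁' = M₂ ∧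
      IsDemicapDecomposition M₂ D₂ D₂' ∧ correspondingCap D₂ D₂' = M₁ ∧
      -- the demicap decomposition of `C'` corresponding to `C`
      (∀ E, (E = D₁ ∨ E = D₁' ∨ E = D₂ ∨ E = D₂') →
        ∀ D'' D''' : Finset Point,
          D'' = C'.filter (fun b => numLines E b = 1) → D''' = C' \ D'' →
          IsDemicapDecomposition C' D'' D''' ∧ correspondingCap D'' D''' = C ∧
          ∀ G H : Finset Point, IsDemicapDecomposition C' G H → correspondingCap G H = C →
            ({G, H} : Finset (Finset Point)) = {D'', D'''}) := by
  obtain ⟨e, rfl, rfl⟩ := exists_coordinates_of_isCap_union hD.1 hD.2.1 hD.2.2.1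
    (by rw [hD.2.2.2]; exact hC.1)
  obtain ⟨a, ha⟩ := e.exists_code_eq (n := 0) (by decide +kernel)
  have hCm : C = e.pts maskC := by
    rw [← hD.2.2.2, ← e.pts_or]
    congr 1
  obtain ⟨hk₁, hk₂, hk₃, hkG, hkH⟩ := correspondsB_all
  have hC'm : C' = e.pts maskC' := by rw [hC', e.correspondsB_iff.1 hk₁]
  have hS₁m : S₁ = e.pts maskS₁ := by rw [hS₁, e.completesOnly_pts, completesOnlyB_maskD.1]
  have hS₂m : S₂ = e.pts maskS₂ := by rw [hS₂, e.completesOnly_pts, completesOnlyB_maskD.2]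
  clear hC' hS₁ hS₂
  subst hCm hC'm hS₁m hS₂m
  have hspec : ∀ m ∈ [maskC, maskC', maskM₁, maskM₂], IsMaximalCap (e.pts m) ∧
      (e.pts m).card = 20 ∧ ∀ b, IsAnchor b (e.pts m) ↔ b = a := by
    intro m hm
    obtain ⟨-, h₁, h₂, h₃⟩ := e.anchoredCapB_spec (List.all_eq_true.1 anchoredCapB_all m hm) ha
    obtain ⟨-, h₁', -, -⟩ :=
      e.anchoredCapB_spec (List.all_eq_true.1 anchoredCapB_all maskC (by simp)) ha
    exact ⟨hC.of_card_eq h₂ (by rw [h₁, h₁']), h₁, h₃⟩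
  have hdemi := List.all_eq_true.1 demicapB_all
  have hS₁D : IsDemicapDecomposition (e.pts maskS₁) (e.pts maskD₁) (e.pts maskD₂) :=
    e.isDemicapDecomposition_pts (hdemi maskD₁ (by simp)) (hdemi maskD₂ (by simp))
      (by decide +kernel)
  have hS₂D : IsDemicapDecomposition (e.pts maskS₂) (e.pts maskD₁') (e.pts maskD₂') :=
    e.isDemicapDecomposition_pts (hdemi maskD₁' (by simp)) (hdemi maskD₂' (by simp))
      (by decide +kernel)
  have hM₁D : IsDemicapDecomposition (e.pts maskM₁) (e.pts maskD₁) (e.pts maskD₁') :=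
    e.isDemicapDecomposition_pts (hdemi maskD₁ (by simp)) (hdemi maskD₁' (by simp))
      (by decide +kernel)
  have hM₂D : IsDemicapDecomposition (e.pts maskM₂) (e.pts maskD₂) (e.pts maskD₂') :=
    e.isDemicapDecomposition_pts (hdemi maskD₂ (by simp)) (hdemi maskD₂' (by simp))
      (by decide +kernel)
  have hC'D : IsDemicapDecomposition (e.pts maskC') (e.pts maskG) (e.pts maskH) :=
    e.isDemicapDecomposition_pts (hdemi maskG (by simp)) (hdemi maskH (by simp))
      (by decide +kernel)
  have hmask : ∀ m ∈ [maskS₁, maskS₂, maskC', maskG, maskH], IsMask m := by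
    have : ∀ m ∈ [maskS₁, maskS₂, maskC', maskG, maskH], m &&& toMask codes = m := by
      decide +kernel
    exact fun m hm => isMask_of_and_eq (this m hm)
  have hpair₁ := e.isCompletablePair_one ha hspec pairwise_masks or_masks capSplittings_maskM
  -- The same criterion with the roles of the two pairs of caps exchanged.
  have hpair₂ := e.isCompletablePair_one (c := maskM₁) (c' := maskM₂) (m₁ := maskC) (m₂ := maskC')
    ha (fun m hm => hspec m (by simp only [List.mem_cons, List.not_mem_nil] at hm ⊢; tauto))
    (by decide +kernel) (by decide +kernel) capSplittings_maskC
  refine ⟨a, (hspec maskC (by simp)).2.2, ?_, ?_, ?_, ?_, e.pts maskD₁, e.pts maskD₁', e.pts maskD₂,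
    e.pts maskD₂', e.pts maskM₁, e.pts maskM₂, hS₁D, hS₂D, e.pts_or _ _, e.pts_or _ _,
    (hspec maskM₁ (by simp)).1, (hspec maskM₂ (by simp)).1, ?_, hpair₁.1, hpair₁.2, hpair₂.2, hM₁D,
    e.correspondsB_iff.1 hk₂, hM₂D, e.correspondsB_iff.1 hk₃, ?_⟩
  · rw [← hS₁D.2.2.2, Finset.card_union_of_disjoint hS₁D.2.2.1, hS₁D.1.card, hS₁D.2.1.card]
  · rw [← hS₂D.2.2.2, Finset.card_union_of_disjoint hS₂D.2.2.1, hS₂D.1.card, hS₂D.2.1.card]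
  · rw [e.ncard_demicapDecompositions (hmask _ (by simp)) decompositions_maskS₁.1,
      decompositions_maskS₁.2]
  · rw [e.ncard_demicapDecompositions (hmask _ (by simp)) decompositions_maskS₂.1,
      decompositions_maskS₂.2]
  · intro E F hE hES hF hFS
    constructor
    · intro h
      obtain ⟨m, hm, rfl⟩ := e.exists_mask E
      obtain ⟨n, hn, rfl⟩ := e.exists_mask F
      rw [← e.pts_or] at h
      rcases eq_of_capB_or m (e.mem_demicaps hm hE hES) n (e.mem_demicaps hn hF hFS)
        (e.capB_iff.2 h.1) with ⟨rfl, rfl⟩ | ⟨rfl, rfl⟩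
      · exact Or.inl ⟨rfl, rfl⟩
      · exact Or.inr ⟨rfl, rfl⟩
    · rintro (⟨rfl, rfl⟩ | ⟨rfl, rfl⟩) <;> rw [← e.pts_or]
      exacts [(hspec maskM₁ (by simp)).1, (hspec maskM₂ (by simp)).1]
  · intro E hE D'' D''' hD'' hD'''
    have hGH : maskC' ^^^ maskG = maskH := by decide +kernel
    have hHG : maskC' ^^^ maskH = maskG := by decide +kernel
    have huniq : ∀ G H : Finset Point, IsDemicapDecomposition (e.pts maskC') G H →
        correspondingCap G H = e.pts maskC →
        ({G, H} : Finset (Finset Point)) = {e.pts maskG, e.pts maskH} := by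
      intro G H h hc
      obtain ⟨m, -, -, hm, -, rfl, rfl, -⟩ :=
        e.exists_masks_of_decomposition (hmask maskC' (by simp)) h
      rcases eq_of_corresponds_maskC m hm (e.correspondsB_iff.2 hc) with rfl | rfl
      · rw [hGH]
      · rw [hHG, Finset.pair_comm]
    -- Whichever half `D''` is, the other is its complement, and uniqueness concerns the unordered
    -- pair, so both cases end alike.
    have hcases : D'' = e.pts maskG ∨ D'' = e.pts maskH := by
      obtain ⟨m, hm, rfl⟩ : ∃ m ∈ [maskD₁, maskD₁', maskD₂, maskD₂'], E = e.pts m := by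
        simpa using hE
      rw [hD'']
      refine (completing_eq m hm).imp (fun h => ?_) fun h => ?_
      all_goals
        rw [e.forall_codes] at h
        ext p
        rw [Finset.mem_filter, e.mem_pts, e.mem_pts, e.numLines_pts, h]
    rcases hcases with h | h
    · have h' : D''' = e.pts maskH := by
        rw [hD''', h, ← hC'D.2.2.2, Finset.union_sdiff_cancel_left hC'D.2.2.1]
      rw [h, h']
      exact ⟨hC'D, e.correspondsB_iff.1 hkG, huniq⟩
    · have h' : D''' = e.pts maskG := by
        rw [hD''', h, ← hC'D.2.2.2, Finset.union_sdiff_cancel_right hC'D.2.2.1]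
      rw [h, h', Finset.pair_comm (e.pts maskH)]
      exact ⟨hC'D.symm, e.correspondsB_iff.1 hkH, huniq⟩
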